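/- Let $n\ge 1$ and let $\mathbb{H}^n=\mathbb{C}^n\times\mathbb{R}$ be the Heisenberg group with product $(z,t)(z',t')=(z+z',\,t+t'+\operatorname{Im}(z\cdot\overline{z'}))$. Let $K\subset U(n)$ be a compact connected subgroup such that $(K,\mathbb{H}^n)$ is a Gelfand pair, i.e. the convolution algebra of those functions in $L^1(\mathbb{H}^n)$ that are invariant under $k\cdot(z,t)=(kz,t)$, $k\in K$, is commutative. Assume that the action of $K$ on $\mathbb{C}^n$ is polar: there is a real linear subspace $T\subset\mathbb{C}^n$ that meets every $K$-orbit and satisfies $\operatorname{Re}\langle Xx,y\rangle=0$ for all $x,y\in T$ and all $X$ in the Lie algebra of $K$. Fix such a $T$ and let $M=\{k\in K: kq=q \text{ for all } q\in T\}$. Suppose that $\dim V_\delta^M=1$ for every irreducible unitary representation $\delta$ of $K$, on a space $V_\delta$, whose space $V_\delta^M$ of $M$-fixed vectors is nonzero. Then there exist $J\in U(n)$ and positive integers $n_1,\dots,n_m$ with $n_1+\cdots+n_m=n$ such that $$\mathcal{P}(\mathbb{C}^n_{\mathbb{R}})^{K}=\mathcal{P}(\mathbb{C}^n_{\mathbb{R}})^{K_0},\qquad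 K_0=J\,[U(n_1)\times\cdots\times U(n_m)]\,J^{-1},$$ where $U(n_1)\times\cdots\times U(n_m)\subset U(n)$ is the group of block diagonal unitary matrices with blocks of these sizes, and, for a subgroup $G\subset U(n)$, $\mathcal{P}(\mathbb{C}^n_{\mathbb{R}})^{G}$ denotes the algebra of polynomials in $z$ and $\bar z$ with complex coefficients that are invariant under $G$. -/

import Mathlib

open MeasureTheory

noncomputable section

namespace PolarGelfand

/-- The unitary group `U(n)`, with the topology induced from the `n × n` complex matrices. -/
abbrev UGroup (n : ℕ) := Matrix.unitaryGroup (Fin n) ℂ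

/-- The action of `U(n)` on `ℂⁿ`. -/
def act {n : ℕ} (k : UGroup n) (z : Fin n → ℂ) : Fin n → ℂ :=
  Matrix.mulVec (k : Matrix (Fin n) (Fin n) ℂ) z

/-- The Hermitian form `z · w̄ = ∑ zⱼ w̄ⱼ` on `ℂⁿ`; its real part is the Euclidean inner
product of the underlying real space. -/
def herm {n : ℕ} (z w : Fin n → ℂ) : ℂ := z ⬝ᵥ star w

/-! ### Polar actions -/

/-- The Lie algebra of a closed subgroup `K` of `U(n)`: the matrices `X` with
`exp (t X) ∈ K` for all real `t`. -/
def lieAlg {n : ℕ} (K : Subgroup (UGroup n)) : Set (Matrix (Fin n) (Fin n) ℂ) :=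
  {X | ∀ t : ℝ, ∃ k ∈ K, (k : Matrix (Fin n) (Fin n) ℂ) = NormedSpace.exp (t • X)}

/-- `T` is a `K`-transversal domain: a real linear subspace of `ℂⁿ` that meets every `K`-orbit
and is orthogonal to the orbit at each of its points. The action of `K` is polar if and only if
such a `T` exists. -/
structure IsTransversalDomain {n : ℕ} (K : Subgroup (UGroup n))
    (T : Submodule ℝ (Fin n → ℂ)) : Prop where
  meets : ∀ z : Fin n → ℂ, ∃ k ∈ K, act k z ∈ T
  orthogonal : ∀ x ∈ T, ∀ y ∈ T, ∀ X ∈ lieAlg K, (herm (Matrix.mulVec X x) y).re = 0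

/-- The pointwise stabilizer `M = K_T` of `T` in `K`. -/
def stabilizer {n : ℕ} (K : Subgroup (UGroup n)) (T : Submodule ℝ (Fin n → ℂ)) :
    Subgroup K where
  carrier := {k | ∀ q ∈ T, act (k : UGroup n) q = q}
  one_mem' := by
    intro q _
    simp [act]
  mul_mem' := by
    intro a b ha hb q hq
    have h : act ((a * b : K) : UGroup n) q = act (a : UGroup n) (act (b : UGroup n) q) := by
      simp [act, Matrix.mulVec_mulVec]
    rw [h, hb q hq, ha q hq]
  inv_mem' := by
    intro a ha q hq
    have h : act ((a⁻¹ * a : K) : UGroup n) q =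
        act ((a⁻¹ : K) : UGroup n) (act (a : UGroup n) q) := by
      simp only [act, Matrix.mulVec_mulVec]
      rfl
    rw [ha q hq, inv_mul_cancel] at h
    rw [← h]
    simp [act]

/-! ### Class one representations -/

/-- Every irreducible unitary representation `δ` of `K` with a nonzero `M`-fixed vector satisfies
`dim V_δ^M = 1`. (Irreducible unitary representations of a compact group are finite
dimensional.) -/
def ClassOneDimOne {n : ℕ} (K : Subgroup (UGroup n)) (M : Subgroup K) : Prop :=
  ∀ (V : Type) [NormedAddCommGroup V] [InnerProductSpace ℂ V] [FiniteDimensional ℂ V]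
    (δ : Representation ℂ K V),
    (∀ k v w, inner ℂ (δ k v) (δ k w) = inner ℂ v w) →
    (∀ v, Continuous fun k => δ k v) →
    δ.IsIrreducible →
    Representation.invariants (δ.comp M.subtype) ≠ ⊥ →
    Module.finrank ℂ (Representation.invariants (δ.comp M.subtype)) = 1

/-! ### The Heisenberg group and Gelfand pairs -/

/-- The underlying manifold `ℂⁿ × ℝ` of the Heisenberg group; its Haar measure is Lebesgue
measure `volume`. -/
abbrev Heis (n : ℕ) := (Fin n → ℂ) × ℝ

/-- The group law `(z,t)(z',t') = (z + z', t + t' + Im (z · z̄'))`. -/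
def heisMul {n : ℕ} (a b : Heis n) : Heis n :=
  (a.1 + b.1, a.2 + b.2 + (herm a.1 b.1).im)

/-- The inverse `(z,t)⁻¹ = (-z,-t)`. -/
def heisInv {n : ℕ} (a : Heis n) : Heis n := (-a.1, -a.2)

/-- The action `k · (z,t) = (k · z, t)` by automorphisms. -/
def heisAct {n : ℕ} (k : UGroup n) (a : Heis n) : Heis n := (act k a.1, a.2)

/-- Convolution on the Heisenberg group. -/
def heisConv {n : ℕ} (f g : Heis n → ℂ) (a : Heis n) : ℂ :=
  ∫ b, f (heisMul a (heisInv b)) * g b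

/-- `f` represents an element of `L¹_K(ℍⁿ)`. -/
def IsInvariantL1 {n : ℕ} (K : Subgroup (UGroup n)) (f : Heis n → ℂ) : Prop :=
  Integrable f ∧ ∀ k ∈ K, (fun a => f (heisAct k a)) =ᵐ[volume] f

/-- `(K, ℍⁿ)` is a Gelfand pair: the convolution algebra `L¹_K(ℍⁿ)` is commutative. -/
def IsGelfandPair {n : ℕ} (K : Subgroup (UGroup n)) : Prop :=
  ∀ f g : Heis n → ℂ, IsInvariantL1 K f → IsInvariantL1 K g →
    heisConv f g =ᵐ[volume] heisConv g f

/-! ### Invariant polynomials -/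

/-- The value at `z` of a polynomial in the variables `z` (left) and `z̄` (right). -/
def evalAt {n : ℕ} (z : Fin n → ℂ) : MvPolynomial (Fin n ⊕ Fin n) ℂ →ₐ[ℂ] ℂ :=
  MvPolynomial.aeval (Sum.elim z (star z))

/-- The algebra of `G`-invariant polynomials in `z` and `z̄` with complex coefficients, i.e.
invariant polynomials on the real vector space underlying `ℂⁿ`. -/
def invariantPolynomials {n : ℕ} (G : Subgroup (UGroup n)) :
    Subalgebra ℂ (MvPolynomial (Fin n ⊕ Fin n) ℂ) where
  carrier := {p | ∀ k ∈ G, ∀ z, evalAt (act k z) p = evalAt z p}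
  mul_mem' := by
    intro p q hp hq k hk z
    rw [map_mul, map_mul, hp k hk z, hq k hk z]
  add_mem' := by
    intro p q hp hq k hk z
    rw [map_add, map_add, hp k hk z, hq k hk z]
  algebraMap_mem' := by
    intro c k _ z
    rw [AlgHom.commutes, AlgHom.commutes]

/-! ### Block diagonal unitary groups -/

/-- The block diagonal embedding of `U(n₁) × ⋯ × U(n_m)` into `U(n)`, `n = n₁ + ⋯ + n_m`, the
blocks being intervals of consecutive indices. -/
def blockHom {n m : ℕ} (ν : Fin m → ℕ) (h : ∑ j, ν j = n) :
    (∀ j, UGroup (ν j)) →* UGroup n where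
  toFun U := ⟨Matrix.reindex (finSigmaFinEquiv.trans (finCongr h))
      (finSigmaFinEquiv.trans (finCongr h))
      (Matrix.blockDiagonal' fun j => (U j : Matrix (Fin (ν j)) (Fin (ν j)) ℂ)), by
    have hU : ∀ j, (U j : Matrix (Fin (ν j)) (Fin (ν j)) ℂ) *
        (U j : Matrix (Fin (ν j)) (Fin (ν j)) ℂ).conjTranspose = 1 :=
      fun j => Matrix.mem_unitaryGroup_iff.1 (U j).2
    rw [Matrix.mem_unitaryGroup_iff, Matrix.star_eq_conjTranspose, Matrix.conjTranspose_reindex,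
      Matrix.blockDiagonal'_conjTranspose, Matrix.reindex_apply, Matrix.reindex_apply,
      Matrix.submatrix_mul_equiv, ← Matrix.blockDiagonal'_mul]
    simp only [hU]
    have h1 : Matrix.blockDiagonal' (fun j => (1 : Matrix (Fin (ν j)) (Fin (ν j)) ℂ)) = 1 :=
      Matrix.blockDiagonal'_one
    rw [h1, Matrix.submatrix_one_equiv]⟩
  map_one' := by
    apply Subtype.ext
    have h1 : Matrix.blockDiagonal' (fun j => (1 : Matrix (Fin (ν j)) (Fin (ν j)) ℂ)) = 1 :=
      Matrix.blockDiagonal'_one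
    change Matrix.reindex _ _ (Matrix.blockDiagonal' fun j =>
      (1 : Matrix (Fin (ν j)) (Fin (ν j)) ℂ)) = 1
    rw [h1, Matrix.reindex_apply, Matrix.submatrix_one_equiv]
  map_mul' := by
    intro U W
    apply Subtype.ext
    change Matrix.reindex _ _ (Matrix.blockDiagonal' fun j =>
      (U j : Matrix (Fin (ν j)) (Fin (ν j)) ℂ) * (W j : Matrix (Fin (ν j)) (Fin (ν j)) ℂ)) =
      Matrix.reindex _ _ (Matrix.blockDiagonal' fun j => (U j : Matrix (Fin (ν j)) (Fin (ν j)) ℂ)) *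
      Matrix.reindex _ _ (Matrix.blockDiagonal' fun j => (W j : Matrix (Fin (ν j)) (Fin (ν j)) ℂ))
    rw [Matrix.blockDiagonal'_mul, Matrix.reindex_apply, Matrix.reindex_apply,
      Matrix.reindex_apply, Matrix.submatrix_mul_equiv]

/-- `U(n₁) × ⋯ × U(n_m)` as a subgroup of `U(n)`. -/
def blockUnitary {n m : ℕ} (ν : Fin m → ℕ) (h : ∑ j, ν j = n) : Subgroup (UGroup n) :=
  (blockHom ν h).range

/-- The conjugate subgroup `J G J⁻¹`. -/
def conjSubgroup {n : ℕ} (J : UGroup n) (G : Subgroup (UGroup n)) : Subgroup (UGroup n) :=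
  G.map (MulAut.conj J).toMonoidHom

end PolarGelfand

end

open MeasureTheory

noncomputable section

namespace PolarGelfand

open Filter Topology

variable {n : ℕ}

/-! ### The Hermitian form and the squared norm -/

/-! Split `ℂⁿ` orthogonally into minimal `K`-invariant subspaces `W_j`, with projections `P_j`, and
let `K₀` be the product of the full unitary groups of the `W_j`. Since `K ⊆ K₀`, only one inclusion
has content: a `K`-invariant polynomial must be `K₀`-invariant.

Geometry of `T`. A nonzero vector of `W_j` can be moved by `K` into `T`, so `W_j` has a nonzero
`M`-fixed vector; by the dimension hypothesis these vectors form a line `ℂ e_j`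
(`exists_fixed_line`). For `q ∈ T` each `P_j q` is `M`-fixed, so `T` lies in the complex span of the
`e_j`. Given `z` and `u ∈ K₀`, move `z` and `u z` by `K` to points `∑ c_j e_j` and `∑ c'_j e_j` of
`T`. Block norms are preserved, so `|c_j| = |c'_j|`, and the two points differ only by a phase on
each block.

Analysis. It remains to see that the Gelfand property makes invariant polynomials blind to these
phases (`evalAt_phase_eq`). Convolve `F(z) h(t)`, with `h(t) = t` near `0`, with an `ε`-dilate of
`G(w) k(s)`. The `ε²` term of the commutator yields `∫ dF_z(w) Im(z · w̄) G(w) dw = 0`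
(`integral_fderiv_mul_im_eq_zero`). If `G` is a radial bump composed with the inverse of a Hermitian
matrix `S` commuting with `K`, this reads `dF_z(i S² z) = 0`. Taking `S = 1` and `S = 1 + P_j`
isolates `dF_z(i P_j z) = 0`, the infinitesimal form of phase invariance on `W_j`. -/

lemma herm_mulVec_left (A : Matrix (Fin n) (Fin n) ℂ) (z w : Fin n → ℂ) :
    herm (A.mulVec z) w = herm z (A.conjTranspose.mulVec w) := by
  simp only [herm, Matrix.star_mulVec, Matrix.conjTranspose_conjTranspose]
  rw [dotProduct_comm, Matrix.dotProduct_mulVec, dotProduct_comm]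

/-- The squared Euclidean norm `∑ |zⱼ|²`. -/
def normSqSum (z : Fin n → ℂ) : ℝ := ∑ i, Complex.normSq (z i)

lemma herm_self (z : Fin n → ℂ) : herm z z = (normSqSum z : ℂ) := by
  simp [herm, normSqSum, dotProduct, Complex.mul_conj]

lemma conjTranspose_mul_coe (k : UGroup n) :
    (k : Matrix (Fin n) (Fin n) ℂ).conjTranspose * (k : Matrix (Fin n) (Fin n) ℂ) = 1 :=
  Matrix.mem_unitaryGroup_iff'.1 k.2

lemma coe_mul_conjTranspose (k : UGroup n) :
    (k : Matrix (Fin n) (Fin n) ℂ) * (k : Matrix (Fin n) (Fin n) ℂ).conjTranspose = 1 :=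
  Matrix.mem_unitaryGroup_iff.1 k.2

lemma herm_act (k : UGroup n) (z w : Fin n → ℂ) : herm (act k z) (act k w) = herm z w := by
  rw [act, herm_mulVec_left, act, Matrix.mulVec_mulVec, conjTranspose_mul_coe, Matrix.one_mulVec]

lemma normSqSum_act (k : UGroup n) (z : Fin n → ℂ) : normSqSum (act k z) = normSqSum z := by
  have h := herm_act k z z
  rw [herm_self, herm_self] at h
  exact_mod_cast h

lemma normSqSum_nonneg (z : Fin n → ℂ) : 0 ≤ normSqSum z :=
  Finset.sum_nonneg fun _ _ => Complex.normSq_nonneg _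

lemma normSqSum_eq_zero {z : Fin n → ℂ} : normSqSum z = 0 ↔ z = 0 := by
  rw [normSqSum, Finset.sum_eq_zero_iff_of_nonneg fun _ _ => Complex.normSq_nonneg _]
  simp [funext_iff]

lemma normSqSum_smul (c : ℂ) (z : Fin n → ℂ) :
    normSqSum (c • z) = Complex.normSq c * normSqSum z := by
  simp [normSqSum, Finset.mul_sum]

lemma normSqSum_neg (z : Fin n → ℂ) : normSqSum (-z) = normSqSum z := by
  simp [normSqSum]

lemma sq_norm_le_normSqSum (z : Fin n → ℂ) : ‖z‖ ^ 2 ≤ normSqSum z := by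
  have h : ‖z‖ ≤ Real.sqrt (normSqSum z) := by
    rw [pi_norm_le_iff_of_nonneg (Real.sqrt_nonneg _)]
    intro i
    apply Real.le_sqrt_of_sq_le
    rw [← Complex.normSq_eq_norm_sq]
    exact Finset.single_le_sum (f := fun i => Complex.normSq (z i))
      (fun _ _ => Complex.normSq_nonneg _) (Finset.mem_univ i)
  calc ‖z‖ ^ 2 ≤ Real.sqrt (normSqSum z) ^ 2 := by gcongr
    _ = normSqSum z := Real.sq_sqrt (normSqSum_nonneg z)

lemma contDiff_normSqSum {m : WithTop ℕ∞} : ContDiff ℝ m (normSqSum (n := n)) := by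
  have : (normSqSum (n := n)) = fun z => ∑ i, ‖z i‖ ^ 2 := by
    funext z
    simp [normSqSum, Complex.normSq_eq_norm_sq]
  rw [this]
  refine ContDiff.sum fun i _ => ?_
  exact (contDiff_apply ℝ ℂ i).norm_sq ℝ

lemma continuous_herm : Continuous fun p : (Fin n → ℂ) × (Fin n → ℂ) => herm p.1 p.2 := by
  unfold herm
  fun_prop

/-! ### Cutoff functions -/

/-- A smooth bump function on `ℝ`, equal to `1` on `[-R, R]`. -/
def cutoff (R : ℝ) (hR : 0 < R) : ContDiffBump (0 : ℝ) := ⟨R, R + 1, hR, by linarith⟩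

lemma hasCompactSupport_cutoff_normSqSum (R : ℝ) (hR : 0 < R) :
    HasCompactSupport fun z : Fin n → ℂ => cutoff R hR (normSqSum z) := by
  refine HasCompactSupport.intro (isCompact_closedBall (0 : Fin n → ℂ) (R + 1)) fun z hz => ?_
  apply (cutoff R hR).zero_of_le_dist
  have h1 : R + 1 < ‖z‖ := by simpa using hz
  have h2 := sq_norm_le_normSqSum z
  rw [Real.dist_0_eq_abs, abs_of_nonneg (normSqSum_nonneg z)]
  change R + 1 ≤ _
  nlinarith

lemma contDiff_cutoff_normSqSum (R : ℝ) (hR : 0 < R) :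
    ContDiff ℝ 1 fun z : Fin n → ℂ => cutoff R hR (normSqSum z) :=
  (cutoff R hR).contDiff.comp contDiff_normSqSum

/-! ### Linear changes of variables -/

/-- The Jacobian factor is chosen before the integrand and its codomain, so a scalar test function
can determine it for vector-valued integrals. Only its positivity matters later. -/
lemma exists_integral_comp_eq_smul {E : Type*} [NormedAddCommGroup E] [NormedSpace ℝ E]
    [FiniteDimensional ℝ E] [MeasurableSpace E] [BorelSpace E] (μ : Measure E)
    [μ.IsAddHaarMeasure] (A : E ≃L[ℝ] E) :
    ∃ κ : ℝ, 0 < κ ∧ ∀ {F : Type} [NormedAddCommGroup F] [NormedSpace ℝ F] (ψ : E → F),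
      ∫ u, ψ (A u) ∂μ = κ • ∫ u, ψ u ∂μ := by
  have hdet : LinearMap.det ((A : E →L[ℝ] E) : E →ₗ[ℝ] E) ≠ 0 :=
    (LinearEquiv.isUnit_det' A.toLinearEquiv).ne_zero
  refine ⟨|(LinearMap.det ((A : E →L[ℝ] E) : E →ₗ[ℝ] E))⁻¹|, abs_pos.2 (inv_ne_zero hdet), ?_⟩
  intro F _ _ ψ
  have h := A.toHomeomorph.measurableEmbedding.integral_map (μ := μ) ψ
  have h2 := Measure.map_linearMap_addHaar_eq_smul_addHaar μ hdet
  have h3 : Measure.map (A.toHomeomorph : E → E) μ =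
      Measure.map ((A : E →L[ℝ] E) : E →ₗ[ℝ] E) μ := rfl
  rw [h3, h2, integral_smul_measure, ENNReal.toReal_ofReal (abs_nonneg _)] at h
  exact h.symm

/-- An invertible matrix as a continuous real-linear automorphism of `ℂⁿ`. -/
def matrixEquiv (A B : Matrix (Fin n) (Fin n) ℂ) (h : A * B = 1) (h' : B * A = 1) :
    (Fin n → ℂ) ≃L[ℝ] (Fin n → ℂ) :=
  ((Matrix.toLin'OfInv h' h).restrictScalars ℝ).toContinuousLinearEquiv

lemma matrixEquiv_apply (A B : Matrix (Fin n) (Fin n) ℂ) (h : A * B = 1) (h' : B * A = 1)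
    (z : Fin n → ℂ) : matrixEquiv A B h h' z = A.mulVec z := rfl

/-! ### Second moments of radial functions -/

/-- The Jacobian factor of a unitary map is `1` because it fixes the nonzero integral of the
invariant function `ρ`; no determinant is computed. -/
lemma integral_act_eq {ρ : (Fin n → ℂ) → ℝ} (hρ : ∀ k : UGroup n, ∀ u, ρ (act k u) = ρ u)
    (hpos : 0 < ∫ u, ρ u) (k : UGroup n) (ψ : (Fin n → ℂ) → ℂ) :
    ∫ u, ψ (act k u) = ∫ u, ψ u := by
  obtain ⟨κ, -, hκ⟩ := exists_integral_comp_eq_smul (volume : Measure (Fin n → ℂ))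
    (matrixEquiv _ _ (coe_mul_conjTranspose k) (conjTranspose_mul_coe k))
  have h1 : κ = 1 := by
    have h := hκ ρ
    have h2 : ∀ u, ρ (matrixEquiv _ _ (coe_mul_conjTranspose k) (conjTranspose_mul_coe k) u)
        = ρ u := hρ k
    simp only [h2, smul_eq_mul] at h
    exact (mul_eq_right₀ hpos.ne').1 h.symm
  have h := hκ ψ
  rw [h1, one_smul] at h
  exact h

/-- The diagonal unitary matrix with entries of modulus one. -/
def diagUnitary (d : Fin n → ℂ) (hd : ∀ i, d i * star (d i) = 1) : UGroup n :=
  ⟨Matrix.diagonal d, by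
    rw [Matrix.mem_unitaryGroup_iff, Matrix.star_eq_conjTranspose, Matrix.diagonal_conjTranspose,
      Matrix.diagonal_mul_diagonal]
    simp only [Pi.star_apply, hd]
    exact Matrix.diagonal_one⟩

lemma act_diagUnitary (d : Fin n → ℂ) (hd : ∀ i, d i * star (d i) = 1) (u : Fin n → ℂ)
    (a : Fin n) : act (diagUnitary d hd) u a = d a * u a := by
  simp [act, diagUnitary, Matrix.mulVec_diagonal]

/-- A permutation matrix as a unitary matrix. -/
def permUnitary (σ : Equiv.Perm (Fin n)) : UGroup n :=
  ⟨σ.permMatrix ℂ, by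
    rw [Matrix.mem_unitaryGroup_iff, Matrix.star_eq_conjTranspose, Matrix.conjTranspose_permMatrix,
      ← Matrix.permMatrix_mul]
    simp⟩

lemma act_permUnitary (σ : Equiv.Perm (Fin n)) (u : Fin n → ℂ) (a : Fin n) :
    act (permUnitary σ) u a = u (σ a) := by
  simp [act, permUnitary, Matrix.permMatrix_mulVec]

/-- The scalar matrix `i` changes the sign of the integrand. -/
lemma integral_mul_mul_radial {ρ : (Fin n → ℂ) → ℝ}
    (hρ : ∀ k : UGroup n, ∀ u, ρ (act k u) = ρ u) (hpos : 0 < ∫ u, ρ u)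
    (a b : Fin n) : ∫ u : Fin n → ℂ, u a * u b * (ρ u : ℂ) = 0 := by
  have h := integral_act_eq hρ hpos (diagUnitary (fun _ => Complex.I) (by simp))
    fun u => u a * u b * (ρ u : ℂ)
  simp only [hρ, act_diagUnitary] at h
  have h2 : ∀ u : Fin n → ℂ, Complex.I * u a * (Complex.I * u b) * (ρ u : ℂ)
      = -(u a * u b * (ρ u : ℂ)) := by
    intro u
    linear_combination (u a * u b * (ρ u : ℂ)) * Complex.I_mul_I
  simp only [h2, integral_neg] at h
  exact self_eq_neg.1 h.symm

/-- Reversing the sign of the single coordinate `a` changes the sign of the integrand. -/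
lemma integral_mul_conj_radial_of_ne {ρ : (Fin n → ℂ) → ℝ}
    (hρ : ∀ k : UGroup n, ∀ u, ρ (act k u) = ρ u) (hpos : 0 < ∫ u, ρ u)
    {a b : Fin n} (hab : a ≠ b) :
    ∫ u : Fin n → ℂ, u a * star (u b) * (ρ u : ℂ) = 0 := by
  have h := integral_act_eq hρ hpos (diagUnitary (Function.update 1 a (-1)) (by
      intro i
      by_cases hi : i = a
      · subst hi; simp
      · simp [hi]))
    fun u => u a * star (u b) * (ρ u : ℂ)
  simp only [hρ, act_diagUnitary] at h
  simp only [Function.update_self, Function.update_of_ne hab.symm, Pi.one_apply, one_mul,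
    neg_mul, integral_neg] at h
  exact self_eq_neg.1 h.symm

lemma integral_mul_conj_radial {ρ : (Fin n → ℂ) → ℝ}
    (hρ : ∀ k : UGroup n, ∀ u, ρ (act k u) = ρ u) (hpos : 0 < ∫ u, ρ u)
    (a b : Fin n) :
    ∫ u : Fin n → ℂ, u a * star (u a) * (ρ u : ℂ) =
      ∫ u : Fin n → ℂ, u b * star (u b) * (ρ u : ℂ) := by
  have h := integral_act_eq hρ hpos (permUnitary (Equiv.swap a b))
    fun u => u a * star (u a) * (ρ u : ℂ)
  simp only [hρ, act_permUnitary, Equiv.swap_apply_left] at h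
  exact h.symm

/-- The second moments of a radial density on `ℂⁿ`. -/
lemma exists_integral_im_herm_smul {ρ : (Fin n → ℂ) → ℝ}
    (hρ : ∀ k : UGroup n, ∀ u, ρ (act k u) = ρ u) (hpos : 0 < ∫ u, ρ u)
    (hc : Continuous ρ) (hs : HasCompactSupport ρ)
    (hnn : ∀ u, 0 ≤ ρ u) (h0 : ∀ u, normSqSum u ≤ 1 → ρ u ≠ 0) :
    ∃ c : ℝ, c ≠ 0 ∧ ∀ v : Fin n → ℂ,
      ∫ u, ((herm v u).im * ρ u) • u = c • (Complex.I • v) := by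
  rcases isEmpty_or_nonempty (Fin n) with hE | ⟨⟨a₀⟩⟩
  · exact ⟨1, one_ne_zero, fun v => Subsingleton.elim _ _⟩
  have hcs : ∀ φ : (Fin n → ℂ) → ℂ, Continuous φ → Integrable fun u => φ u * (ρ u : ℂ) := by
    intro φ hφ
    refine (hφ.mul (Complex.continuous_ofReal.comp hc)).integrable_of_hasCompactSupport ?_
    exact HasCompactSupport.mul_left (hs.comp_left Complex.ofReal_zero)
  set q : ℝ := ∫ u : Fin n → ℂ, Complex.normSq (u a₀) * ρ u with hq
  have hq0 : 0 < q := by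
    have hcont : Continuous fun u : Fin n → ℂ => Complex.normSq (u a₀) * ρ u :=
      (Complex.continuous_normSq.comp (continuous_apply a₀)).mul hc
    refine hcont.integral_pos_of_hasCompactSupport_nonneg_nonzero hs.mul_left
      (fun u => mul_nonneg (Complex.normSq_nonneg _) (hnn u)) (x := Pi.single a₀ 1) ?_
    refine mul_ne_zero (by simp) (h0 _ ?_)
    rw [normSqSum, Finset.sum_eq_single a₀] <;> simp +contextual
  have hqc : ∀ a, ∫ u : Fin n → ℂ, u a * star (u a) * (ρ u : ℂ) = (q : ℂ) := by
    intro a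
    rw [integral_mul_conj_radial hρ hpos a a₀, hq, ← integral_complex_ofReal]
    congr 1
    funext u
    simp [Complex.mul_conj]
  -- From `Im x = (x - x̄) / (2i)`, the only surviving moment contributes `q / (2i) = -(q/2) i`.
  refine ⟨-(q / 2), by simp [hq0.ne'], fun v => ?_⟩
  have hint : Integrable fun u : Fin n → ℂ => ((herm v u).im * ρ u) • u := by
    have h1 : Continuous fun u : Fin n → ℂ => (herm v u).im * ρ u :=
      (Complex.continuous_im.comp (continuous_herm.comp (continuous_const.prodMk continuous_id))).mul
        hc
    exact (h1.smul continuous_id).integrable_of_hasCompactSupport (hs.mul_left.smul_right)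
  funext a
  have happ : (∫ u, ((herm v u).im * ρ u) • u) a = ∫ u, (((herm v u).im * ρ u) • u) a :=
    ((ContinuousLinearMap.proj (R := ℝ) (φ := fun _ : Fin n => ℂ) a).integral_comp_comm hint).symm
  rw [happ]
  have hexp : ∀ u : Fin n → ℂ, (((herm v u).im * ρ u) • u) a =
      ∑ b, (v b / (2 * Complex.I) * (u a * star (u b) * (ρ u : ℂ)) -
        star (v b) / (2 * Complex.I) * (u a * u b * (ρ u : ℂ))) := by
    intro u
    have him : ((herm v u).im : ℂ) = ∑ b, (v b * star (u b) - star (v b) * u b)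
        / (2 * Complex.I) := by
      rw [← Finset.sum_div, Complex.im_eq_sub_conj, herm, dotProduct, map_sum,
        ← Finset.sum_sub_distrib]
      simp
    rw [Pi.smul_apply, Complex.real_smul, Complex.ofReal_mul, him, Finset.sum_mul, Finset.sum_mul]
    refine Finset.sum_congr rfl fun b _ => ?_
    ring
  simp only [hexp]
  have i1 : ∀ b, Integrable fun u : Fin n → ℂ =>
      v b / (2 * Complex.I) * (u a * star (u b) * (ρ u : ℂ)) := fun b =>
    (hcs (fun u => u a * star (u b)) (by fun_prop)).const_mul _
  have i2 : ∀ b, Integrable fun u : Fin n → ℂ =>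
      star (v b) / (2 * Complex.I) * (u a * u b * (ρ u : ℂ)) := fun b =>
    (hcs (fun u => u a * u b) (by fun_prop)).const_mul _
  rw [integral_finsetSum _ fun b _ => by exact (i1 b).sub (i2 b)]
  simp only [integral_sub (i1 _) (i2 _), integral_const_mul, integral_mul_mul_radial hρ hpos,
    mul_zero, sub_zero]
  rw [Finset.sum_eq_single a]
  · rw [hqc, Pi.smul_apply, Pi.smul_apply, Complex.real_smul, smul_eq_mul]
    push_cast
    field_simp
    linear_combination (v a * q) * Complex.I_sq
  · intro b _ hb
    rw [integral_mul_conj_radial_of_ne hρ hpos hb.symm, mul_zero]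
  · simp

/-! ### Commutativity of convolution as an integral identity -/

lemma herm_neg_left (z w : Fin n → ℂ) : herm (-z) w = -herm z w := by
  simp [herm]

lemma herm_neg_right (z w : Fin n → ℂ) : herm z (-w) = -herm z w := by
  simp [herm]

lemma herm_add_left (z z' w : Fin n → ℂ) : herm (z + z') w = herm z w + herm z' w := by
  simp [herm, add_dotProduct]

lemma herm_add_right (z w w' : Fin n → ℂ) : herm z (w + w') = herm z w + herm z w' := by
  simp [herm, dotProduct_add]

lemma herm_self_im (z : Fin n → ℂ) : (herm z z).im = 0 := by
  simp [herm_self]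

lemma herm_im_swap (z w : Fin n → ℂ) : (herm z w).im = -(herm w z).im := by
  have : herm z w = star (herm w z) := by
    simp [herm, dotProduct, mul_comm]
  rw [this]
  simp

lemma herm_real_smul_right (ε : ℝ) (z w : Fin n → ℂ) : herm z (ε • w) = ε * herm z w := by
  have : star (ε • w) = (ε : ℂ) • star w := by
    funext i
    simp
  rw [herm, this, dotProduct_smul, smul_eq_mul, herm]

lemma continuous_heisMul : Continuous fun p : Heis n × Heis n => heisMul p.1 p.2 := by
  have h : Continuous fun p : Heis n × Heis n => herm p.1.1 p.2.1 :=
    continuous_herm.comp (by fun_prop : Continuous fun p : Heis n × Heis n => (p.1.1, p.2.1))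
  unfold heisMul
  fun_prop

lemma continuous_heisInv : Continuous (heisInv (n := n)) := by
  unfold heisInv
  fun_prop

/-- The map `b ↦ b⁻¹ a` of the Heisenberg group. -/
def invMulHomeomorph (a : Heis n) : Heis n ≃ₜ Heis n where
  toFun b := heisMul (heisInv b) a
  invFun b := heisMul a (heisInv b)
  left_inv b := by
    ext
    · simp [heisMul, heisInv]
    · simp [heisMul, heisInv, herm_neg_left, herm_neg_right, herm_add_right, herm_self_im,
        herm_im_swap b.1 a.1]
      ring
  right_inv b := by
    ext
    · simp [heisMul, heisInv]
    · simp [heisMul, heisInv, herm_neg_left, herm_neg_right, herm_add_left, herm_self_im,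
        herm_im_swap b.1 a.1]
      ring
  continuous_toFun := continuous_heisMul.comp (continuous_heisInv.prodMk continuous_const)
  continuous_invFun := continuous_heisMul.comp (continuous_const.prodMk continuous_heisInv)

/-- `b ↦ b⁻¹ a` reflects the `ℂⁿ` factor and, over each point of it, reflects the `ℝ` factor: a skew
product of measure-preserving maps. -/
lemma measurePreserving_invMul (a : Heis n) :
    MeasurePreserving (invMulHomeomorph a) volume volume := by
  have h1 : MeasurePreserving (fun w : Fin n → ℂ => a.1 - w) volume volume :=
    Measure.measurePreserving_sub_left volume a.1
  have h2 : ∀ᵐ w : Fin n → ℂ, Measure.map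
      (fun s : ℝ => (a.2 - (herm w a.1).im) - s) volume = volume :=
    Eventually.of_forall fun w =>
      (Measure.measurePreserving_sub_left volume (a.2 - (herm w a.1).im)).map_eq
  have hm : Measurable (Function.uncurry fun (w : Fin n → ℂ) (s : ℝ) =>
      (a.2 - (herm w a.1).im) - s) := by
    have h : Continuous fun p : (Fin n → ℂ) × ℝ => herm p.1 a.1 :=
      continuous_herm.comp (by fun_prop : Continuous fun p : (Fin n → ℂ) × ℝ => (p.1, a.1))
    apply Continuous.measurable
    unfold Function.uncurry
    fun_prop
  have h := h1.skew_product hm h2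
  have heq : (invMulHomeomorph a : Heis n → Heis n) =
      fun p => (a.1 - p.1, a.2 - (herm p.1 a.1).im - p.2) := by
    funext b
    ext1
    · change -b.1 + a.1 = a.1 - b.1
      abel
    · change -b.2 + a.2 + (herm (-b.1) a.1).im = a.2 - (herm b.1 a.1).im - b.2
      rw [herm_neg_left, Complex.neg_im]
      ring
  rw [heq]
  exact h

/-- Puts both orders of convolution in the form of an integral against `g`, so that the commutator
compares `f (a b⁻¹)` with `f (b⁻¹ a)`. -/
lemma heisConv_eq_integral_invMul (f g : Heis n → ℂ) (a : Heis n) :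
    heisConv g f a = ∫ b, f (heisMul (heisInv b) a) * g b := by
  have h := (measurePreserving_invMul a).integral_comp
    (invMulHomeomorph a).measurableEmbedding (fun b => g (heisMul a (heisInv b)) * f b)
  rw [heisConv, ← h]
  congr 1
  funext b
  have h2 : heisMul a (heisInv (invMulHomeomorph a b)) = b := (invMulHomeomorph a).left_inv b
  rw [h2, mul_comm]
  rfl

instance isAddHaarMeasure_volume_heis : (volume : Measure (Heis n)).IsAddHaarMeasure :=
  Measure.prod.instIsAddHaarMeasure (volume : Measure (Fin n → ℂ)) (volume : Measure ℝ)

/-- For `f`, `g` in the commutative algebra, concentrating `g` by a dilation. -/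
lemma ae_integral_scaled_eq {K : Subgroup (UGroup n)} (hK : IsGelfandPair K) {f g : Heis n → ℂ}
    (hf : Continuous f) (hfs : HasCompactSupport f) (hfK : ∀ k ∈ K, ∀ a, f (heisAct k a) = f a)
    (hg : Continuous g) (hgs : HasCompactSupport g) (hgK : ∀ k ∈ K, ∀ a, g (heisAct k a) = g a)
    {ε : ℝ} (hε : ε ≠ 0) :
    ∀ᵐ a : Heis n, ∫ b, f (heisMul a (heisInv (ε • b))) * g b =
      ∫ b, f (heisMul (heisInv (ε • b)) a) * g b := by
  -- The scaling is the isotropic one of the vector space, not an automorphism of the group; it only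
  -- has to commute with `K` and have constant Jacobian.
  have hdil : Continuous fun b : Heis n => ε⁻¹ • b := continuous_const_smul _
  have h1 : IsInvariantL1 K f :=
    ⟨hf.integrable_of_hasCompactSupport hfs, fun k hk => Eventually.of_forall (hfK k hk)⟩
  have h2 : IsInvariantL1 K fun b => g (ε⁻¹ • b) := by
    refine ⟨(hg.comp hdil).integrable_of_hasCompactSupport (hgs.comp_smul (inv_ne_zero hε)),
      fun k hk => Eventually.of_forall fun a => ?_⟩
    have : ε⁻¹ • heisAct k a = heisAct k (ε⁻¹ • a) := by
      ext1
      · simp [heisAct, act, Matrix.mulVec_smul]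
      · simp [heisAct]
    simp only [this, hgK k hk]
  filter_upwards [hK _ _ h1 h2] with a ha
  rw [heisConv_eq_integral_invMul f, heisConv] at ha
  have key : ∀ φ : Heis n → ℂ, ∫ b, φ (ε • b) * g b =
      |(ε ^ Module.finrank ℝ (Heis n))⁻¹| • ∫ b, φ b * g (ε⁻¹ • b) := by
    intro φ
    rw [← Measure.integral_comp_smul volume (fun b => φ b * g (ε⁻¹ • b)) ε]
    simp only [inv_smul_smul₀ hε]
  rw [key fun b => f (heisMul a (heisInv b)), key fun b => f (heisMul (heisInv b) a), ha]

/-! ### Second-order expansion of the commutator -/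

/-- A compactly supported function on `ℝ` that is the identity near the origin. -/
def localId (t : ℝ) : ℝ := t * cutoff 2 two_pos t

lemma localId_of_abs_le {t : ℝ} (ht : |t| ≤ 2) : localId t = t := by
  rw [localId, (cutoff 2 two_pos).one_of_mem_closedBall, mul_one]
  simpa [cutoff] using ht

lemma contDiff_localId : ContDiff ℝ 1 localId := contDiff_id.mul (cutoff 2 two_pos).contDiff

lemma hasCompactSupport_localId : HasCompactSupport localId :=
  (cutoff 2 two_pos).hasCompactSupport.mul_left

lemma tendsto_inv_mul_sub {E : Type*} [NormedAddCommGroup E] [NormedSpace ℝ E] {F : E → ℂ}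
    {L : E →L[ℝ] ℂ} {z : E} (hF : HasFDerivAt F L z) (w : E) :
    Tendsto (fun N : ℕ => (((N : ℝ) + 1 : ℝ) : ℂ) *
      (F (z - ((N : ℝ) + 1)⁻¹ • w) - F (z + ((N : ℝ) + 1)⁻¹ • w))) atTop (𝓝 (-2 * L w)) := by
  have h1 : HasDerivAt (fun x : ℝ => F (z - x • w)) (-(L w)) 0 := by
    have hl : HasDerivAt (fun x : ℝ => z - x • w) (-w) 0 := by
      simpa using ((hasDerivAt_id (0 : ℝ)).smul_const w).const_sub z
    have hF' : HasFDerivAt F L (z - (0 : ℝ) • w) := by simpa using hF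
    have h := hF'.comp_hasDerivAt (0 : ℝ) hl
    rwa [map_neg] at h
  have h2 : HasDerivAt (fun x : ℝ => F (z + x • w)) (L w) 0 := by
    have hl : HasDerivAt (fun x : ℝ => z + x • w) w 0 := by
      simpa using ((hasDerivAt_id (0 : ℝ)).smul_const w).const_add z
    have hF' : HasFDerivAt F L (z + (0 : ℝ) • w) := by simpa using hF
    exact hF'.comp_hasDerivAt (0 : ℝ) hl
  have h3 := (h1.sub h2).tendsto_slope_zero
  have h4 : Tendsto (fun N : ℕ => ((N : ℝ) + 1)⁻¹) atTop (𝓝[≠] 0) := by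
    refine tendsto_nhdsWithin_iff.2 ⟨?_, Eventually.of_forall fun N => ?_⟩
    · simpa [one_div] using tendsto_one_div_add_atTop_nhds_zero_nat (𝕜 := ℝ)
    · have : (0 : ℝ) < (N : ℝ) + 1 := by positivity
      simpa using this.ne'
  have h5 := h3.comp h4
  have h6 : -(L w) - L w = -2 * L w := by ring
  rw [h6] at h5
  refine h5.congr fun N => ?_
  simp [Complex.real_smul]

lemma tendsto_mul_localId_sub {t : ℝ} (ht : |t| < 1) (s β : ℝ) :
    Tendsto (fun N : ℕ => ((N : ℝ) + 1) *
      (localId (t - ((N : ℝ) + 1)⁻¹ * s - ((N : ℝ) + 1)⁻¹ * β) -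
        localId (t - ((N : ℝ) + 1)⁻¹ * s + ((N : ℝ) + 1)⁻¹ * β))) atTop (𝓝 (-2 * β)) := by
  apply tendsto_const_nhds.congr'
  -- For such `N` both arguments are within `|t| + 1 < 2` of `0`, where `localId` is the identity,
  -- so the sequence is eventually constant.
  obtain ⟨N₀, hN₀⟩ := exists_nat_ge (|s| + |β|)
  filter_upwards [eventually_ge_atTop N₀] with N hN
  have hN1 : (0 : ℝ) < (N : ℝ) + 1 := by positivity
  have hN2 : (N₀ : ℝ) ≤ N := by exact_mod_cast hN
  have hb : ((N : ℝ) + 1)⁻¹ * |s| + ((N : ℝ) + 1)⁻¹ * |β| ≤ 1 := by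
    rw [← mul_add, inv_mul_le_iff₀ hN1]
    linarith
  have hs : |((N : ℝ) + 1)⁻¹ * s| = ((N : ℝ) + 1)⁻¹ * |s| := by
    rw [abs_mul, abs_of_pos (inv_pos.2 hN1)]
  have hβ : |((N : ℝ) + 1)⁻¹ * β| = ((N : ℝ) + 1)⁻¹ * |β| := by
    rw [abs_mul, abs_of_pos (inv_pos.2 hN1)]
  rw [← hs, ← hβ] at hb
  set x := ((N : ℝ) + 1)⁻¹ * s
  set y := ((N : ℝ) + 1)⁻¹ * β with hy
  have e1 := abs_lt.1 ht
  have e2 := abs_le.1 (le_refl |x|)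
  have e3 := abs_le.1 (le_refl |y|)
  rw [localId_of_abs_le (abs_le.2 ⟨by linarith, by linarith⟩),
    localId_of_abs_le (abs_le.2 ⟨by linarith, by linarith⟩), hy]
  field_simp
  ring

lemma hasCompactSupport_ofReal {E : Type*} [TopologicalSpace E] {G : E → ℝ}
    (hG : HasCompactSupport G) : HasCompactSupport fun w => (G w : ℂ) :=
  hG.comp_left (g := Complex.ofReal) Complex.ofReal_zero

lemma hasCompactSupport_fst_mul_snd (A : (Fin n → ℂ) → ℂ) (h : ℝ → ℝ) (hA : HasCompactSupport A)
    (hh : HasCompactSupport h) : HasCompactSupport fun b : Heis n => A b.1 * (h b.2 : ℂ) := by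
  refine HasCompactSupport.intro (hA.isCompact.prod hh.isCompact) fun b hb => ?_
  by_cases h1 : b.1 ∈ tsupport A
  · have h2 : b.2 ∉ tsupport h := fun h2 => hb ⟨h1, h2⟩
    simp [image_eq_zero_of_notMem_tsupport h2]
  · simp [image_eq_zero_of_notMem_tsupport h1]

/-- The difference of the two `h` factors is odd in `w`, while `G` is even, so `w ↦ -w` replaces
`F(z - εw)` by `F(z + εw)`. Subtracting leaves a product of two differences, each of order `ε` when
`F` and `h` are differentiable, ready to be divided by `ε²`. -/
lemma integral_symmetrized_eq_zero {F : (Fin n → ℂ) → ℂ} (hF : Continuous F)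
    {G : (Fin n → ℂ) → ℝ} (hG : Continuous G) (hGs : HasCompactSupport G)
    (hGn : ∀ w, G (-w) = G w) {h k : ℝ → ℝ} (hh : Continuous h) (hk : Continuous k)
    (hks : HasCompactSupport k) (z : Fin n → ℂ) (t ε : ℝ)
    (heq : ∫ b : Heis n, (F (heisMul (z, t) (heisInv (ε • b))).1 *
          (h (heisMul (z, t) (heisInv (ε • b))).2 : ℂ)) * ((G b.1 : ℂ) * (k b.2 : ℂ)) =
        ∫ b : Heis n, (F (heisMul (heisInv (ε • b)) (z, t)).1 *
          (h (heisMul (heisInv (ε • b)) (z, t)).2 : ℂ)) * ((G b.1 : ℂ) * (k b.2 : ℂ))) :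
    ∫ b : Heis n, (F (z - ε • b.1) - F (z + ε • b.1)) *
      ((h (t - ε * b.2 - ε * (herm z b.1).im) - h (t - ε * b.2 + ε * (herm z b.1).im) : ℝ) : ℂ) *
      ((G b.1 : ℂ) * (k b.2 : ℂ)) = 0 := by
  have hgs : HasCompactSupport fun b : Heis n => (G b.1 : ℂ) * (k b.2 : ℂ) :=
    hasCompactSupport_fst_mul_snd (fun w => (G w : ℂ)) k (hasCompactSupport_ofReal hGs) hks
  have hβ : Continuous fun b : Heis n => (herm z b.1).im :=
    Complex.continuous_im.comp (continuous_herm.comp (continuous_const.prodMk continuous_fst))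
  have hgc : Continuous fun b : Heis n => (G b.1 : ℂ) * (k b.2 : ℂ) := by fun_prop
  have hint : ∀ φ : Heis n → ℂ, Continuous φ →
      Integrable fun b : Heis n => φ b * ((G b.1 : ℂ) * (k b.2 : ℂ)) := fun φ hφ =>
    (hφ.mul hgc).integrable_of_hasCompactSupport hgs.mul_left
  set D : Heis n → ℂ := fun b =>
    ((h (t - ε * b.2 - ε * (herm z b.1).im) - h (t - ε * b.2 + ε * (herm z b.1).im) : ℝ) : ℂ)
    with hD
  have hDc : Continuous D := by fun_prop
  have h1 : ∫ b : Heis n, F (z - ε • b.1) * D b * ((G b.1 : ℂ) * (k b.2 : ℂ)) = 0 := by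
    have e1 : ∀ b : Heis n, heisMul (z, t) (heisInv (ε • b)) =
        (z - ε • b.1, t - ε * b.2 - ε * (herm z b.1).im) := by
      intro b
      ext1
      · simp [heisMul, heisInv, sub_eq_add_neg]
      · simp [heisMul, heisInv, sub_eq_add_neg, herm_neg_right, herm_real_smul_right]
    have e2 : ∀ b : Heis n, heisMul (heisInv (ε • b)) (z, t) =
        (z - ε • b.1, t - ε * b.2 + ε * (herm z b.1).im) := by
      intro b
      ext1
      · simp [heisMul, heisInv, sub_eq_add_neg, add_comm]
      · simp [heisMul, heisInv, sub_eq_add_neg, herm_neg_left, herm_im_swap (ε • b.1) z,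
          herm_real_smul_right, add_comm]
    simp only [e1, e2] at heq
    rw [← sub_eq_zero, ← integral_sub] at heq
    · rw [← heq]
      congr 1
      funext b
      simp only [hD]
      push_cast
      ring
    · exact hint (fun b => F (z - ε • b.1) *
        (h (t - ε * b.2 - ε * (herm z b.1).im) : ℂ)) (by fun_prop)
    · exact hint (fun b => F (z - ε • b.1) *
        (h (t - ε * b.2 + ε * (herm z b.1).im) : ℂ)) (by fun_prop)
  have h2 : ∫ b : Heis n, F (z + ε • b.1) * D b * ((G b.1 : ℂ) * (k b.2 : ℂ)) = 0 := by
    let flip : Heis n ≃ₜ Heis n := (Homeomorph.neg (Fin n → ℂ)).prodCongr (Homeomorph.refl ℝ)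
    have hmp : MeasurePreserving flip volume volume :=
      (Measure.measurePreserving_neg (volume : Measure (Fin n → ℂ))).prod
        (MeasurePreserving.id (volume : Measure ℝ))
    have h3 := hmp.integral_comp flip.measurableEmbedding
      fun b => F (z - ε • b.1) * D b * ((G b.1 : ℂ) * (k b.2 : ℂ))
    rw [h1] at h3
    have e : ∀ b : Heis n, F (z - ε • (flip b).1) * D (flip b) *
        ((G (flip b).1 : ℂ) * (k (flip b).2 : ℂ)) =
        -(F (z + ε • b.1) * D b * ((G b.1 : ℂ) * (k b.2 : ℂ))) := by
      intro b
      have f1 : (flip b).1 = -b.1 := rfl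
      have f2 : (flip b).2 = b.2 := rfl
      have f3 : D (flip b) = -D b := by
        simp only [hD, f1, f2, herm_neg_right, Complex.neg_im, mul_neg, sub_neg_eq_add,
          ← sub_eq_add_neg]
        push_cast
        ring
      rw [f3, f1, f2, hGn, smul_neg, sub_neg_eq_add]
      ring
    simp only [e, integral_neg, neg_eq_zero] at h3
    exact h3
  have hs := integral_sub (hint (fun b => F (z - ε • b.1) * D b) (by fun_prop))
    (hint (fun b => F (z + ε • b.1) * D b) (by fun_prop))
  rw [h1, h2, sub_zero] at hs
  rw [← hs]
  congr 1
  funext b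
  ring

/-- The first-order consequence of the vanishing of the symmetrized commutators. -/
lemma integral_fderiv_mul_im_eq_zero {F : (Fin n → ℂ) → ℂ} (hF : ContDiff ℝ 1 F)
    (hFs : HasCompactSupport F) {G : (Fin n → ℂ) → ℝ} (hG : Continuous G)
    (hGs : HasCompactSupport G) {k : ℝ → ℝ} (hk : Continuous k) (hks : HasCompactSupport k)
    (hk1 : ∫ s, k s ≠ 0) (z : Fin n → ℂ) {t : ℝ} (ht : |t| < 1)
    (hzero : ∀ N : ℕ, ∫ b : Heis n,
      (F (z - ((N : ℝ) + 1)⁻¹ • b.1) - F (z + ((N : ℝ) + 1)⁻¹ • b.1)) *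
      ((localId (t - ((N : ℝ) + 1)⁻¹ * b.2 - ((N : ℝ) + 1)⁻¹ * (herm z b.1).im) -
        localId (t - ((N : ℝ) + 1)⁻¹ * b.2 + ((N : ℝ) + 1)⁻¹ * (herm z b.1).im) : ℝ) : ℂ) *
      ((G b.1 : ℂ) * (k b.2 : ℂ)) = 0) :
    ∫ w, fderiv ℝ F z w * (((herm z w).im * G w : ℝ) : ℂ) = 0 := by
  obtain ⟨C, hC⟩ := hF.lipschitzWith_of_hasCompactSupport hFs one_ne_zero
  obtain ⟨C', hC'⟩ := contDiff_localId.lipschitzWith_of_hasCompactSupport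
    hasCompactSupport_localId one_ne_zero
  have hFc := hF.continuous
  have hlc := contDiff_localId.continuous
  have hgs : HasCompactSupport fun b : Heis n => (G b.1 : ℂ) * (k b.2 : ℂ) :=
    hasCompactSupport_fst_mul_snd (fun w => (G w : ℂ)) k (hasCompactSupport_ofReal hGs) hks
  have hβ : Continuous fun b : Heis n => (herm z b.1).im :=
    Complex.continuous_im.comp (continuous_herm.comp (continuous_const.prodMk continuous_fst))
  have hgc : Continuous fun b : Heis n => (G b.1 : ℂ) * (k b.2 : ℂ) := by fun_prop
  -- With `ε = 1/(N+1)`, each difference absorbs one factor `N + 1`. Lipschitz bounds on `F` and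
  -- `localId` supply a majorant independent of `N`.
  have hlim : Tendsto (fun N : ℕ => ∫ b : Heis n,
      ((((N : ℝ) + 1 : ℝ) : ℂ) *
        (F (z - ((N : ℝ) + 1)⁻¹ • b.1) - F (z + ((N : ℝ) + 1)⁻¹ • b.1))) *
      ((((N : ℝ) + 1) *
        (localId (t - ((N : ℝ) + 1)⁻¹ * b.2 - ((N : ℝ) + 1)⁻¹ * (herm z b.1).im) -
        localId (t - ((N : ℝ) + 1)⁻¹ * b.2 + ((N : ℝ) + 1)⁻¹ * (herm z b.1).im)) : ℝ) : ℂ) *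
      ((G b.1 : ℂ) * (k b.2 : ℂ))) atTop
      (𝓝 (∫ b : Heis n, (-2 * fderiv ℝ F z b.1) * ((-2 * (herm z b.1).im : ℝ) : ℂ) *
        ((G b.1 : ℂ) * (k b.2 : ℂ)))) := by
    refine tendsto_integral_of_dominated_convergence
      (fun b => (C * (2 * ‖b.1‖)) * (C' * (2 * |(herm z b.1).im|)) *
        ‖(G b.1 : ℂ) * (k b.2 : ℂ)‖) (fun N => ?_) ?_ (fun N => ?_) ?_
    · apply Continuous.aestronglyMeasurable
      fun_prop
    · refine Continuous.integrable_of_hasCompactSupport (by fun_prop) ?_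
      exact HasCompactSupport.mul_left hgs.norm
    · refine Eventually.of_forall fun b => ?_
      have hN1 : (0 : ℝ) < (N : ℝ) + 1 := by positivity
      rw [norm_mul, norm_mul]
      gcongr
      · rw [norm_mul, Complex.norm_real, Real.norm_of_nonneg hN1.le]
        have h1 := hC.dist_le_mul (z - ((N : ℝ) + 1)⁻¹ • b.1) (z + ((N : ℝ) + 1)⁻¹ • b.1)
        have h2 : (z - ((N : ℝ) + 1)⁻¹ • b.1) - (z + ((N : ℝ) + 1)⁻¹ • b.1) =
            (-(2 * ((N : ℝ) + 1)⁻¹)) • b.1 := by module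
        rw [dist_eq_norm, dist_eq_norm, h2, norm_smul, norm_neg,
          Real.norm_of_nonneg (by positivity)] at h1
        calc ((N : ℝ) + 1) * _ ≤ ((N : ℝ) + 1) * (C * (2 * ((N : ℝ) + 1)⁻¹ * ‖b.1‖)) := by gcongr
          _ = C * (2 * ‖b.1‖) := by field_simp
      · rw [Complex.norm_real, norm_mul, Real.norm_of_nonneg hN1.le]
        have h1 := hC'.dist_le_mul
          (t - ((N : ℝ) + 1)⁻¹ * b.2 - ((N : ℝ) + 1)⁻¹ * (herm z b.1).im)
          (t - ((N : ℝ) + 1)⁻¹ * b.2 + ((N : ℝ) + 1)⁻¹ * (herm z b.1).im)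
        have h2 : (t - ((N : ℝ) + 1)⁻¹ * b.2 - ((N : ℝ) + 1)⁻¹ * (herm z b.1).im) -
            (t - ((N : ℝ) + 1)⁻¹ * b.2 + ((N : ℝ) + 1)⁻¹ * (herm z b.1).im) =
            -(2 * ((N : ℝ) + 1)⁻¹ * (herm z b.1).im) := by ring
        rw [dist_eq_norm, dist_eq_norm, h2, norm_neg, norm_mul,
          Real.norm_of_nonneg (by positivity : 0 ≤ 2 * ((N : ℝ) + 1)⁻¹),
          Real.norm_eq_abs (herm z b.1).im] at h1
        calc ((N : ℝ) + 1) * _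
            ≤ ((N : ℝ) + 1) * (C' * (2 * ((N : ℝ) + 1)⁻¹ * |(herm z b.1).im|)) := by gcongr
          _ = C' * (2 * |(herm z b.1).im|) := by field_simp
    · refine Eventually.of_forall fun b => ?_
      refine Tendsto.mul (Tendsto.mul ?_ ?_) tendsto_const_nhds
      · exact tendsto_inv_mul_sub
          ((hF.differentiable one_ne_zero).differentiableAt.hasFDerivAt) b.1
      · exact (Complex.continuous_ofReal.tendsto _).comp
          (tendsto_mul_localId_sub ht b.2 (herm z b.1).im)
  have hseq : ∀ N : ℕ, ∫ b : Heis n,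
      ((((N : ℝ) + 1 : ℝ) : ℂ) *
        (F (z - ((N : ℝ) + 1)⁻¹ • b.1) - F (z + ((N : ℝ) + 1)⁻¹ • b.1))) *
      ((((N : ℝ) + 1) *
        (localId (t - ((N : ℝ) + 1)⁻¹ * b.2 - ((N : ℝ) + 1)⁻¹ * (herm z b.1).im) -
        localId (t - ((N : ℝ) + 1)⁻¹ * b.2 + ((N : ℝ) + 1)⁻¹ * (herm z b.1).im)) : ℝ) : ℂ) *
      ((G b.1 : ℂ) * (k b.2 : ℂ)) = 0 := by
    intro N
    have h := congrArg (fun x : ℂ => (((N : ℝ) + 1 : ℝ) : ℂ) ^ 2 * x) (hzero N)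
    simp only [mul_zero] at h
    rw [← integral_const_mul] at h
    rw [← h]
    congr 1
    funext b
    push_cast
    ring
  simp only [hseq] at hlim
  have h0 := tendsto_nhds_unique hlim tendsto_const_nhds
  -- The limit integrand separates, and the `s`-integral is a nonzero factor; `4 = (-2)(-2)`.
  have hprod := integral_prod_mul (μ := (volume : Measure (Fin n → ℂ)))
    (ν := (volume : Measure ℝ)) (L := ℂ)
    (fun w => fderiv ℝ F z w * (((herm z w).im * G w : ℝ) : ℂ)) (fun s => 4 * (k s : ℂ))
  have e : ∀ b : Heis n, (-2 * fderiv ℝ F z b.1) * ((-2 * (herm z b.1).im : ℝ) : ℂ) *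
        ((G b.1 : ℂ) * (k b.2 : ℂ)) =
      fderiv ℝ F z b.1 * (((herm z b.1).im * G b.1 : ℝ) : ℂ) * (4 * (k b.2 : ℂ)) := by
    intro b
    push_cast
    ring
  simp only [e] at h0
  rw [show (volume : Measure (Heis n)) = (volume : Measure (Fin n → ℂ)).prod volume from rfl,
    hprod, integral_const_mul, integral_complex_ofReal] at h0
  refine (mul_eq_zero.1 h0).resolve_right ?_
  exact mul_ne_zero (by norm_num) (Complex.ofReal_ne_zero.2 hk1)

/-- Pulling the derivative out of the moment integral turns the integral identity into a pointwise
statement about the vector field `B`. -/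
lemma fderiv_moment_eq_zero {K : Subgroup (UGroup n)} (hK : IsGelfandPair K)
    {F : (Fin n → ℂ) → ℂ} (hF : ContDiff ℝ 1 F) (hFs : HasCompactSupport F)
    (hFK : ∀ k ∈ K, ∀ z, F (act k z) = F z) {G : (Fin n → ℂ) → ℝ} (hG : Continuous G)
    (hGs : HasCompactSupport G) (hGK : ∀ k ∈ K, ∀ z, G (act k z) = G z)
    (hGn : ∀ w, G (-w) = G w) {B : (Fin n → ℂ) → (Fin n → ℂ)} (hB : Continuous B)
    (hGB : ∀ v, ∫ w, ((herm v w).im * G w) • w = B v) (z : Fin n → ℂ) :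
    fderiv ℝ F z (B z) = 0 := by
  obtain ⟨k, hkc, hks, hkp⟩ : ∃ k : ℝ → ℝ, Continuous k ∧ HasCompactSupport k ∧ ∫ s, k s ≠ 0 :=
    ⟨cutoff 2 two_pos, (cutoff 2 two_pos).continuous, (cutoff 2 two_pos).hasCompactSupport,
      (cutoff 2 two_pos).integral_pos.ne'⟩
  have hlc := contDiff_localId.continuous
  have hFc := hF.continuous
  -- Restricting to countably many scales allows a single exceptional null set.
  have hae : ∀ᵐ a : Heis n, ∀ N : ℕ,
      ∫ b : Heis n, (F (heisMul a (heisInv (((N : ℝ) + 1)⁻¹ • b))).1 *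
          (localId (heisMul a (heisInv (((N : ℝ) + 1)⁻¹ • b))).2 : ℂ)) *
          ((G b.1 : ℂ) * (k b.2 : ℂ)) =
        ∫ b : Heis n, (F (heisMul (heisInv (((N : ℝ) + 1)⁻¹ • b)) a).1 *
          (localId (heisMul (heisInv (((N : ℝ) + 1)⁻¹ • b)) a).2 : ℂ)) *
          ((G b.1 : ℂ) * (k b.2 : ℂ)) := by
    rw [ae_all_iff]
    intro N
    have hN1 : (0 : ℝ) < (N : ℝ) + 1 := by positivity
    refine ae_integral_scaled_eq hK (f := fun a => F a.1 * (localId a.2 : ℂ))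
      (g := fun b => (G b.1 : ℂ) * (k b.2 : ℂ)) ?_
      (hasCompactSupport_fst_mul_snd F localId hFs hasCompactSupport_localId)
      (fun κ hκ a => ?_) ?_
        (hasCompactSupport_fst_mul_snd (fun w => (G w : ℂ)) k (hasCompactSupport_ofReal hGs) hks)
      (fun κ hκ a => ?_) (inv_ne_zero hN1.ne')
    · fun_prop
    · simp only [heisAct, hFK κ hκ]
    · fun_prop
    · simp only [heisAct, hGK κ hκ]
  have hae2 : ∀ᵐ a : Heis n, |a.2| < 1 → fderiv ℝ F a.1 (B a.1) = 0 := by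
    filter_upwards [hae] with a ha ht
    have h0 := integral_fderiv_mul_im_eq_zero hF hFs hG hGs hkc hks hkp a.1 ht
      fun N => integral_symmetrized_eq_zero hFc hG hGs hGn hlc hkc hks a.1 a.2 _ (ha N)
    have hint : Integrable fun w : Fin n → ℂ => ((herm a.1 w).im * G w) • w := by
      have h1 : Continuous fun u : Fin n → ℂ => (herm a.1 u).im * G u :=
        (Complex.continuous_im.comp
          (continuous_herm.comp (continuous_const.prodMk continuous_id))).mul hG
      exact (h1.smul continuous_id).integrable_of_hasCompactSupport (hGs.mul_left.smul_right)
    rw [← hGB a.1, ← (fderiv ℝ F a.1).integral_comp_comm hint, ← h0]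
    congr 1
    funext w
    rw [map_smul, Complex.real_smul, mul_comm]
  -- By continuity, failure at `z` would persist on an open set around `(z, 0)`, which has positive
  -- measure.
  by_contra hne
  have hcont : Continuous fun a : Heis n => fderiv ℝ F a.1 (B a.1) :=
    ((hF.continuous_fderiv one_ne_zero).comp continuous_fst).clm_apply (hB.comp continuous_fst)
  have hopen : IsOpen {a : Heis n | |a.2| < 1 ∧ fderiv ℝ F a.1 (B a.1) ≠ 0} :=
    (isOpen_lt (f := fun a : Heis n => |a.2|) (by fun_prop) continuous_const).inter
      (isOpen_ne_fun hcont continuous_const)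
  have hpos := hopen.measure_pos (volume : Measure (Heis n)) ⟨(z, 0), by simp, hne⟩
  refine hpos.ne' (measure_mono_null ?_ (ae_iff.1 hae2))
  rintro a ⟨h1, h2⟩
  simpa using ⟨h1, h2⟩

/-! ### Infinitesimal invariance of invariant polynomials -/

lemma contDiff_evalAt (p : MvPolynomial (Fin n ⊕ Fin n) ℂ) :
    ContDiff ℝ 1 fun z : Fin n → ℂ => evalAt z p := by
  induction p using MvPolynomial.induction_on with
  | C a => simpa [evalAt] using contDiff_const
  | add p q hp hq => simpa using hp.add hq
  | mul_X p i hp =>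
    simp only [map_mul]
    refine hp.mul ?_
    rcases i with i | i
    · simpa [evalAt] using contDiff_apply ℝ ℂ i
    · have h : ContDiff ℝ 1 fun z : Fin n → ℂ => star (z i) :=
        Complex.conjCLE.contDiff.comp (contDiff_apply ℝ ℂ i)
      simpa [evalAt] using h

/-- The second moments of the image of a radial density under a Hermitian matrix. -/
lemma exists_integral_im_herm_smul_comp {S S' : Matrix (Fin n) (Fin n) ℂ} (h : S * S' = 1)
    (h' : S' * S = 1) (hS : S.conjTranspose = S) :
    ∃ c : ℝ, c ≠ 0 ∧ ∀ v : Fin n → ℂ,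
      ∫ w, ((herm v w).im * cutoff 1 one_pos (normSqSum (S'.mulVec w))) • w =
        c • (Complex.I • (S * S).mulVec v) := by
  have hc : Continuous fun u : Fin n → ℂ => cutoff 1 one_pos (normSqSum u) :=
    (contDiff_cutoff_normSqSum 1 one_pos).continuous
  have hs := hasCompactSupport_cutoff_normSqSum (n := n) 1 one_pos
  have h1 : ∀ u : Fin n → ℂ, normSqSum u ≤ 1 → cutoff 1 one_pos (normSqSum u) ≠ 0 := by
    intro u hu
    rw [(cutoff 1 one_pos).one_of_mem_closedBall]
    · exact one_ne_zero
    · simpa [cutoff, abs_of_nonneg (normSqSum_nonneg u)] using hu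
  have hpos : 0 < ∫ u : Fin n → ℂ, cutoff 1 one_pos (normSqSum u) :=
    hc.integral_pos_of_hasCompactSupport_nonneg_nonzero hs
      (fun u => (cutoff 1 one_pos).nonneg) (x := 0) (h1 0 (by simp [normSqSum]))
  obtain ⟨c, hc0, hcv⟩ := exists_integral_im_herm_smul
    (ρ := fun u : Fin n → ℂ => cutoff 1 one_pos (normSqSum u))
    (fun k u => by rw [normSqSum_act]) hpos hc hs (fun u => (cutoff 1 one_pos).nonneg) h1
  obtain ⟨κ, hκ0, hκ⟩ := exists_integral_comp_eq_smul (volume : Measure (Fin n → ℂ))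
    (matrixEquiv S S' h h')
  refine ⟨κ⁻¹ * c, mul_ne_zero (inv_ne_zero hκ0.ne') hc0, fun v => ?_⟩
  -- Substitute `w = S u`: one `S` moves to `v` inside the Hermitian form, and the other comes out
  -- of the vector integral, producing `S²`.
  have e := hκ fun w => ((herm v w).im * cutoff 1 one_pos (normSqSum (S'.mulVec w))) • w
  have e2 : ∀ u, ((herm v (matrixEquiv S S' h h' u)).im *
      cutoff 1 one_pos (normSqSum (S'.mulVec (matrixEquiv S S' h h' u)))) •
        matrixEquiv S S' h h' u = matrixEquiv S S' h h'
          (((herm (S.mulVec v) u).im * cutoff 1 one_pos (normSqSum u)) • u) := by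
    intro u
    rw [map_smul, matrixEquiv_apply, Matrix.mulVec_mulVec, h', Matrix.one_mulVec,
      herm_mulVec_left, hS]
  simp only [e2] at e
  rw [ContinuousLinearEquiv.integral_comp_comm, hcv, map_smul, matrixEquiv_apply,
    Matrix.mulVec_smul, Matrix.mulVec_mulVec] at e
  rw [mul_smul, e, inv_smul_smul₀ hκ0.ne']

/-- Commutation of `S'` with `K` makes `w ↦ χ(|S' w|²)` an admissible `G`. Multiplying the
polynomial by a radial cutoff keeps `K`-invariance, and near `z` changes nothing. -/
lemma fderiv_evalAt_sq_eq_zero {K : Subgroup (UGroup n)} (hK : IsGelfandPair K)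
    {p : MvPolynomial (Fin n ⊕ Fin n) ℂ} (hp : p ∈ invariantPolynomials K)
    {S S' : Matrix (Fin n) (Fin n) ℂ} (h : S * S' = 1) (h' : S' * S = 1)
    (hS : S.conjTranspose = S)
    (hcomm : ∀ k ∈ K, S' * (k : Matrix (Fin n) (Fin n) ℂ) = k * S') (z : Fin n → ℂ) :
    fderiv ℝ (fun z => evalAt z p) z (Complex.I • (S * S).mulVec z) = 0 := by
  obtain ⟨c, hc0, hc⟩ := exists_integral_im_herm_smul_comp h h' hS
  have hR : 0 < normSqSum z + 1 := by linarith [normSqSum_nonneg z]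
  have hG : Continuous fun w : Fin n → ℂ => cutoff 1 one_pos (normSqSum (S'.mulVec w)) :=
    (contDiff_cutoff_normSqSum 1 one_pos).continuous.comp (by fun_prop)
  have hGs : HasCompactSupport
      fun w : Fin n → ℂ => cutoff 1 one_pos (normSqSum (S'.mulVec w)) :=
    (hasCompactSupport_cutoff_normSqSum (n := n) 1 one_pos).comp_homeomorph
      (matrixEquiv S' S h' h).toHomeomorph
  have hχ : ContDiff ℝ 1 fun z : Fin n → ℂ => (cutoff _ hR (normSqSum z) : ℂ) :=
    Complex.ofRealCLM.contDiff.comp (contDiff_cutoff_normSqSum _ hR)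
  have h0 := fderiv_moment_eq_zero hK
    (F := fun z => evalAt z p * (cutoff _ hR (normSqSum z) : ℂ))
    ((contDiff_evalAt p).mul hχ)
    (HasCompactSupport.mul_left
      (hasCompactSupport_ofReal (hasCompactSupport_cutoff_normSqSum _ hR)))
    (fun k hk z => by rw [hp k hk, normSqSum_act]) hG hGs
    (fun k hk w => by
      have : S'.mulVec (act k w) = act k (S'.mulVec w) := by
        simp only [act, Matrix.mulVec_mulVec, hcomm k hk]
      rw [this, normSqSum_act])
    (fun w => by rw [Matrix.mulVec_neg, normSqSum_neg])
    (B := fun v => c • (Complex.I • (S * S).mulVec v)) (by fun_prop) hc z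
  have hev : (fun z => evalAt z p * (cutoff _ hR (normSqSum z) : ℂ)) =ᶠ[𝓝 z]
      fun z => evalAt z p := by
    have hopen : IsOpen {w : Fin n → ℂ | normSqSum w < normSqSum z + 1} :=
      isOpen_lt (contDiff_normSqSum (m := 1)).continuous continuous_const
    filter_upwards [hopen.mem_nhds (show normSqSum z < normSqSum z + 1 by linarith)] with w hw
    rw [(cutoff _ hR).one_of_mem_closedBall, Complex.ofReal_one, mul_one]
    simpa [cutoff, abs_of_nonneg (normSqSum_nonneg w)] using le_of_lt hw
  rw [hev.fderiv_eq, map_smul] at h0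
  exact (smul_eq_zero.1 h0).resolve_left hc0

/-- An invariant polynomial is annihilated by the rotations of every invariant subspace. -/
lemma fderiv_evalAt_projection_eq_zero {K : Subgroup (UGroup n)} (hK : IsGelfandPair K)
    {p : MvPolynomial (Fin n ⊕ Fin n) ℂ} (hp : p ∈ invariantPolynomials K)
    {P : Matrix (Fin n) (Fin n) ℂ} (hP : P.conjTranspose = P) (hPP : P * P = P)
    (hcomm : ∀ k ∈ K, P * (k : Matrix (Fin n) (Fin n) ℂ) = k * P) (z : Fin n → ℂ) :
    fderiv ℝ (fun z => evalAt z p) z (Complex.I • P.mulVec z) = 0 := by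
  -- As `(1 + P)² = 1 + 3P`, the cases `S = 1` and `S = 1 + P` differ by the field `3 i P z`. Unlike
  -- `P`, the matrix `1 + P` is invertible, with inverse `1 - P/2`.
  have h1 := fderiv_evalAt_sq_eq_zero hK hp (S := 1) (S' := 1) (by simp) (by simp) (by simp)
    (by simp) z
  have h2 := fderiv_evalAt_sq_eq_zero hK hp (S := 1 + P) (S' := 1 - (1 / 2 : ℂ) • P)
    (by
      rw [add_mul, mul_sub, mul_sub, mul_smul_comm, mul_smul_comm, hPP]
      simp only [mul_one, one_mul]
      module)
    (by
      rw [sub_mul, mul_add, mul_add, smul_mul_assoc, smul_mul_assoc, hPP]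
      simp only [mul_one, one_mul]
      module)
    (by rw [Matrix.conjTranspose_add, hP, Matrix.conjTranspose_one])
    (fun k hk => by
      rw [sub_mul, mul_sub, smul_mul_assoc, mul_smul_comm, hcomm k hk, one_mul, mul_one]) z
  have h3 : (1 + P) * (1 + P) = 1 * 1 + (3 : ℂ) • P := by
    rw [add_mul, mul_add, mul_add, hPP]
    simp only [mul_one, one_mul]
    module
  rw [h3, Matrix.add_mulVec, smul_add, map_add, h1, zero_add, Matrix.smul_mulVec] at h2
  have h4 : Complex.I • (3 : ℂ) • P.mulVec z = (3 : ℝ) • (Complex.I • P.mulVec z) := by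
    funext i
    simp
    ring
  rw [h4, map_smul] at h2
  exact (smul_eq_zero.1 h2).resolve_left (by norm_num)

/-- Invariant polynomials do not see independent phases on orthogonal invariant subspaces. -/
lemma evalAt_phase_eq {K : Subgroup (UGroup n)} (hK : IsGelfandPair K)
    {p : MvPolynomial (Fin n ⊕ Fin n) ℂ} (hp : p ∈ invariantPolynomials K) {m : ℕ}
    {P : Fin m → Matrix (Fin n) (Fin n) ℂ} (hP : ∀ j, (P j).conjTranspose = P j)
    (hPP : ∀ j, P j * P j = P j)
    (hcomm : ∀ j, ∀ k ∈ K, P j * (k : Matrix (Fin n) (Fin n) ℂ) = k * P j)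
    (e : Fin m → Fin n → ℂ) (he : ∀ i j, (P i).mulVec (e j) = if i = j then e j else 0)
    (θ : Fin m → ℝ) (c : Fin m → ℂ) :
    evalAt (∑ j, (Complex.exp (θ j * Complex.I) * c j) • e j) p = evalAt (∑ j, c j • e j) p := by
  -- The curve joins the two points at `s = 0` and `s = 1`, and its velocity is a real combination
  -- of the annihilated fields `i P_j z`.
  set γ : ℝ → Fin n → ℂ := fun s =>
    ∑ j, (Complex.exp (s * θ j * Complex.I) * c j) • e j with hγ
  have hγ' : ∀ s, HasDerivAt γ (∑ j, θ j • (Complex.I • (P j).mulVec (γ s))) s := by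
    intro s
    have hPγ : ∀ j, (P j).mulVec (γ s) = (Complex.exp (s * θ j * Complex.I) * c j) • e j := by
      intro j
      simp only [hγ, Matrix.mulVec_sum, Matrix.mulVec_smul, he]
      simp
    simp only [hPγ]
    refine HasDerivAt.fun_sum fun j _ => ?_
    have h1 : HasDerivAt (fun s : ℝ => (s : ℂ) * θ j * Complex.I) (θ j * Complex.I) s := by
      simpa using ((Complex.ofRealCLM.hasDerivAt (x := s)).mul_const (θ j : ℂ)).mul_const Complex.I
    have h2 := ((h1.cexp).mul_const (c j)).smul_const (e j)
    convert h2 using 1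
    funext i
    simp
    ring
  have hderiv : ∀ s, HasDerivAt (fun s => evalAt (γ s) p) 0 s := by
    intro s
    have hd : HasFDerivAt (fun z => evalAt z p) (fderiv ℝ (fun z => evalAt z p) (γ s)) (γ s) :=
      ((contDiff_evalAt p).differentiable one_ne_zero).differentiableAt.hasFDerivAt
    have h := hd.comp_hasDerivAt s (hγ' s)
    rw [map_sum] at h
    simp only [map_smul, fderiv_evalAt_projection_eq_zero hK hp (hP _) (hPP _) (hcomm _),
      smul_zero, Finset.sum_const_zero] at h
    exact h
  have hconst := is_const_of_deriv_eq_zero (fun s => (hderiv s).differentiableAt)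
    (fun s => (hderiv s).deriv) 1 0
  simpa [hγ] using hconst

/-! ### Orthogonal decomposition of unitary representations -/

section Decomposition

variable {G E : Type*} [Group G] [NormedAddCommGroup E] [InnerProductSpace ℂ E]

/-- A minimal nonzero invariant subspace. -/
structure IsMinimalInvariant (ρ : Representation ℂ G E) (U : Submodule ℂ E) : Prop where
  invariant : ∀ g, ∀ v ∈ U, ρ g v ∈ U
  ne_bot : U ≠ ⊥
  eq_of_le : ∀ U' ≤ U, (∀ g, ∀ v ∈ U', ρ g v ∈ U') → U' ≠ ⊥ → U' = U

lemma orthogonal_invariant {ρ : Representation ℂ G E}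
    (hρ : ∀ g v w, inner ℂ (ρ g v) (ρ g w) = inner ℂ v w) {U : Submodule ℂ E}
    (hU : ∀ g, ∀ v ∈ U, ρ g v ∈ U) (g : G) : ∀ v ∈ Uᗮ, ρ g v ∈ Uᗮ := by
  intro v hv
  rw [Submodule.mem_orthogonal] at hv ⊢
  intro u hu
  have h : ρ g (ρ g⁻¹ u) = u := by
    rw [← Module.End.mul_apply, ← map_mul, mul_inv_cancel, map_one, Module.End.one_apply]
  rw [← h, hρ]
  exact hv _ (hU _ _ hu)

/-- Induction on dimension: a proper nonzero invariant subspace `U` of `W` splits it into `U` and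
`Uᗮ ⊓ W`, both invariant and smaller. -/
lemma exists_finset_isMinimalInvariant [FiniteDimensional ℂ E]
    {ρ : Representation ℂ G E}
    (hρ : ∀ g v w, inner ℂ (ρ g v) (ρ g w) = inner ℂ v w) (W : Submodule ℂ E)
    (hW : ∀ g, ∀ v ∈ W, ρ g v ∈ W) :
    ∃ s : Finset (Submodule ℂ E), (∀ U ∈ s, ∀ V ∈ s, U ≠ V → U ⟂ V) ∧
      (∀ U ∈ s, IsMinimalInvariant ρ U) ∧ s.sup id = W := by
  classical
  induction hd : Module.finrank ℂ W using Nat.strong_induction_on generalizing W with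
  | _ d ih =>
  subst hd
  by_cases hbot : W = ⊥
  · exact ⟨∅, by simp, by simp, by simp [hbot]⟩
  by_cases hmin : IsMinimalInvariant ρ W
  · refine ⟨{W}, ?_, by simpa using hmin, by simp⟩
    simp only [Finset.mem_singleton]
    rintro U rfl V rfl h
    exact absurd rfl h
  obtain ⟨U, hUW, hUinv, hU0, hUne⟩ : ∃ U ≤ W, (∀ g, ∀ v ∈ U, ρ g v ∈ U) ∧ U ≠ ⊥ ∧ U ≠ W := by
    by_contra! hcon
    exact hmin ⟨hW, hbot, fun U' h1 h2 h3 => hcon U' h1 h2 h3⟩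
  have hlt : Uᗮ ⊓ W < W := by
    refine lt_of_le_of_ne inf_le_right fun h => hU0 ?_
    have h2 : U ≤ Uᗮ := hUW.trans (inf_eq_right.1 h)
    rw [eq_bot_iff, ← Submodule.inf_orthogonal_eq_bot U]
    exact le_inf le_rfl h2
  obtain ⟨s, hs1, hs2, hs3⟩ := ih _ (Submodule.finrank_lt_finrank_of_lt (hUW.lt_of_ne hUne)) U
    hUinv rfl
  obtain ⟨t, ht1, ht2, ht3⟩ := ih _ (Submodule.finrank_lt_finrank_of_lt hlt) (Uᗮ ⊓ W)
    (fun g v hv => ⟨orthogonal_invariant hρ hUinv g v hv.1, hW g v hv.2⟩) rfl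
  have hst : ∀ A ∈ s, ∀ B ∈ t, A ⟂ B := by
    intro A hA B hB
    have hAU : A ≤ U := hs3 ▸ Finset.le_sup (f := id) hA
    have hBU : B ≤ Uᗮ := (ht3 ▸ Finset.le_sup (f := id) hB : B ≤ Uᗮ ⊓ W).trans inf_le_left
    exact (Submodule.isOrtho_orthogonal_right U).mono hAU hBU
  refine ⟨s ∪ t, ?_, ?_, ?_⟩
  · intro A hA B hB hAB
    rcases Finset.mem_union.1 hA with hA | hA <;> rcases Finset.mem_union.1 hB with hB | hB
    · exact hs1 A hA B hB hAB
    · exact hst A hA B hB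
    · exact (hst B hB A hA).symm
    · exact ht1 A hA B hB hAB
  · intro A hA
    rcases Finset.mem_union.1 hA with hA | hA
    · exact hs2 A hA
    · exact ht2 A hA
  · rw [Finset.sup_union, hs3, ht3]
    exact Submodule.sup_orthogonal_inf_of_hasOrthogonalProjection hUW

lemma exists_orthogonalFamily_isMinimalInvariant [FiniteDimensional ℂ E]
    {ρ : Representation ℂ G E}
    (hρ : ∀ g v w, inner ℂ (ρ g v) (ρ g w) = inner ℂ v w) :
    ∃ (m : ℕ) (W : Fin m → Submodule ℂ E),
      OrthogonalFamily ℂ (fun j => W j) (fun j => (W j).subtypeₗᵢ) ∧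
      DirectSum.IsInternal W ∧ ∀ j, IsMinimalInvariant ρ (W j) := by
  obtain ⟨s, hs1, hs2, hs3⟩ := exists_finset_isMinimalInvariant hρ ⊤ (by simp)
  let f := s.equivFin.symm
  have hO : OrthogonalFamily ℂ (fun j => (f j : Submodule ℂ E))
      (fun j => (f j : Submodule ℂ E).subtypeₗᵢ) := by
    refine OrthogonalFamily.of_pairwise fun i j hij => ?_
    exact hs1 _ (f i).2 _ (f j).2 fun h => hij (f.injective (Subtype.ext h))
  refine ⟨s.card, fun j => (f j : Submodule ℂ E), hO, ?_, fun j => hs2 _ (f j).2⟩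
  rw [hO.isInternal_iff, Submodule.orthogonal_eq_bot_iff, eq_top_iff, ← hs3]
  refine Finset.sup_le fun U hU => ?_
  have h := le_iSup (fun j => (f j : Submodule ℂ E)) (s.equivFin ⟨U, hU⟩)
  simpa [f] using h

/-- The representation on a minimal invariant subspace. -/
def IsMinimalInvariant.rep {ρ : Representation ℂ G E} {U : Submodule ℂ E}
    (hU : IsMinimalInvariant ρ U) : Representation ℂ G U :=
  Subrepresentation.toRepresentation (ρ := ρ) ⟨U, hU.invariant⟩

lemma IsMinimalInvariant.coe_rep {ρ : Representation ℂ G E} {U : Submodule ℂ E}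
    (hU : IsMinimalInvariant ρ U) (g : G) (v : U) : (hU.rep g v : E) = ρ g v := rfl

lemma IsMinimalInvariant.isIrreducible {ρ : Representation ℂ G E} {U : Submodule ℂ E}
    (hU : IsMinimalInvariant ρ U) : hU.rep.IsIrreducible where
  exists_pair_ne := by
    refine ⟨⊥, ⊤, fun h => hU.ne_bot ?_⟩
    rw [eq_bot_iff]
    intro x hx
    have h1 : (⟨x, hx⟩ : U) ∈ (⊤ : Subrepresentation hU.rep) := trivial
    rw [← h] at h1
    have h2 : (⟨x, hx⟩ : U) = 0 := h1
    simpa using congrArg Subtype.val h2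
  eq_bot_or_eq_top τ := by
    by_cases h : τ.toSubmodule.map U.subtype = ⊥
    · left
      apply Subrepresentation.toSubmodule_injective
      change τ.toSubmodule = ⊥
      rw [eq_bot_iff]
      intro x hx
      have h1 : (x : E) ∈ τ.toSubmodule.map U.subtype := ⟨x, hx, rfl⟩
      rw [h, Submodule.mem_bot] at h1
      exact Subtype.ext h1
    · right
      apply Subrepresentation.toSubmodule_injective
      have h2 := hU.eq_of_le _ (Submodule.map_subtype_le U τ.toSubmodule) (by
        rintro g _ ⟨v, hv, rfl⟩
        exact ⟨_, τ.apply_mem_toSubmodule g hv, rfl⟩) h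
      change τ.toSubmodule = ⊤
      rw [eq_top_iff]
      rintro ⟨x, hx⟩ -
      obtain ⟨y, hy, hyx⟩ := h2.ge hx
      have : y = ⟨x, hx⟩ := Subtype.ext hyx
      exact this ▸ hy

end Decomposition

/-! ### The defining representation and its class one constituents -/

/-- The defining representation of a subgroup of `U(n)`. -/
def definingRep (K : Subgroup (UGroup n)) : Representation ℂ K (EuclideanSpace ℂ (Fin n)) where
  toFun k := Matrix.toEuclideanLin ((k : UGroup n) : Matrix (Fin n) (Fin n) ℂ)
  map_one' := by
    ext x
    simp
  map_mul' k l := by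
    ext x
    simp [Matrix.toLpLin_apply, Matrix.mulVec_mulVec]

lemma definingRep_apply (K : Subgroup (UGroup n)) (k : K) (x : EuclideanSpace ℂ (Fin n)) :
    definingRep K k x = WithLp.toLp 2 (act (k : UGroup n) x.ofLp) := rfl

lemma inner_eq_herm (x y : EuclideanSpace ℂ (Fin n)) : inner ℂ x y = herm y.ofLp x.ofLp :=
  EuclideanSpace.inner_eq_star_dotProduct x y

lemma inner_definingRep (K : Subgroup (UGroup n)) (k : K) (v w : EuclideanSpace ℂ (Fin n)) :
    inner ℂ (definingRep K k v) (definingRep K k w) = inner ℂ v w := by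
  simp only [inner_eq_herm, definingRep_apply, herm_act]

lemma mem_invariants_rep_iff {K : Subgroup (UGroup n)} (M : Subgroup K)
    {U : Submodule ℂ (EuclideanSpace ℂ (Fin n))} (hU : IsMinimalInvariant (definingRep K) U)
    (v : U) : v ∈ Representation.invariants (hU.rep.comp M.subtype) ↔
      ∀ k ∈ M, act (k : UGroup n) v.1.ofLp = v.1.ofLp := by
  rw [Representation.mem_invariants]
  constructor
  · intro h k hk
    have h1 : hU.rep k v = v := h ⟨k, hk⟩
    have h2 := hU.coe_rep k v
    rw [h1, definingRep_apply] at h2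
    exact (congrArg WithLp.ofLp h2).symm
  · intro h k
    change hU.rep (k : K) v = v
    apply Subtype.ext
    rw [hU.coe_rep, definingRep_apply, h k k.2]

lemma continuous_rep {K : Subgroup (UGroup n)} {U : Submodule ℂ (EuclideanSpace ℂ (Fin n))}
    (hU : IsMinimalInvariant (definingRep K) U) (v : U) : Continuous fun k => hU.rep k v := by
  rw [continuous_induced_rng]
  change Continuous fun k : K => WithLp.toLp 2
    (((k : UGroup n) : Matrix (Fin n) (Fin n) ℂ).mulVec v.1.ofLp)
  refine (PiLp.continuous_toLp 2 _).comp ?_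
  fun_prop

/-- In a minimal invariant subspace the vectors fixed by `M` form a line. -/
lemma exists_fixed_line {K : Subgroup (UGroup n)} {T : Submodule ℝ (Fin n → ℂ)}
    (hT : IsTransversalDomain K T) (hdim : ClassOneDimOne K (stabilizer K T))
    {U : Submodule ℂ (EuclideanSpace ℂ (Fin n))} (hU : IsMinimalInvariant (definingRep K) U) :
    ∃ e ∈ U, e ≠ 0 ∧ ∀ v ∈ U, (∀ k ∈ stabilizer K T, act (k : UGroup n) v.ofLp = v.ofLp) →
      ∃ c : ℂ, v = c • e := by
  have hne : Representation.invariants (hU.rep.comp (stabilizer K T).subtype) ≠ ⊥ := by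
    obtain ⟨x, hx, hx0⟩ := Submodule.exists_mem_ne_zero_of_ne_bot hU.ne_bot
    obtain ⟨k, hk, hkT⟩ := hT.meets x.ofLp
    rw [Submodule.ne_bot_iff]
    -- Moving `x` into `T` keeps it in `U` and makes it `M`-fixed; it stays nonzero by unitarity.
    refine ⟨hU.rep ⟨k, hk⟩ ⟨x, hx⟩,
      (mem_invariants_rep_iff _ hU _).2 fun l hl => ?_, fun h0 => hx0 ?_⟩
    · rw [hU.coe_rep, definingRep_apply]
      exact hl _ hkT
    · have h1 := inner_definingRep K ⟨k, hk⟩ x x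
      have h2 := hU.coe_rep ⟨k, hk⟩ ⟨x, hx⟩
      rw [h0] at h2
      rw [← h2, Submodule.coe_zero, inner_zero_left] at h1
      exact inner_self_eq_zero.1 h1.symm
  unfold ClassOneDimOne at hdim
  have hV := @hdim U _ _ _
  have h1 := hV hU.rep (fun k v w => inner_definingRep K k v w) (continuous_rep hU)
    hU.isIrreducible hne
  obtain ⟨⟨e, he⟩, he0, hspan⟩ := finrank_eq_one_iff'.1 h1
  refine ⟨e, e.2, fun h => he0 ?_, fun v hv hfix => ?_⟩
  · exact Subtype.ext (Subtype.ext h)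
  · obtain ⟨c, hc⟩ := hspan ⟨⟨v, hv⟩, (mem_invariants_rep_iff _ hU _).2 hfix⟩
    have h2 : c • e = ⟨v, hv⟩ := congrArg Subtype.val hc
    exact ⟨c, (congrArg Subtype.val h2).symm⟩

/-! ### Block structure -/

section Blocks

variable {m : ℕ} (ν : Fin m → ℕ) (h : ∑ j, ν j = n)

/-- The block containing an index. -/
def blockIndex (c : Fin n) : Fin m := ((finSigmaFinEquiv.trans (finCongr h)).symm c).1

/-- The coordinate projection onto a block. -/
def blockProj (j : Fin m) : Matrix (Fin n) (Fin n) ℂ :=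
  Matrix.diagonal fun c => if blockIndex ν h c = j then 1 else 0

lemma blockProj_conjTranspose (j : Fin m) :
    (blockProj ν h j).conjTranspose = blockProj ν h j := by
  rw [blockProj, Matrix.diagonal_conjTranspose]
  congr 1
  funext c
  simp only [Pi.star_apply]
  split_ifs <;> simp

lemma blockProj_mul_self (j : Fin m) : blockProj ν h j * blockProj ν h j = blockProj ν h j := by
  simp [blockProj, Matrix.diagonal_mul_diagonal]

lemma sum_blockProj : ∑ j, blockProj ν h j = 1 := by
  ext c d
  rw [Matrix.sum_apply]
  by_cases hcd : c = d
  · subst hcd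
    simp [blockProj]
  · simp [blockProj, hcd]

lemma blockProj_mul_comm_of_zero {B : Matrix (Fin n) (Fin n) ℂ}
    (hB : ∀ c d, blockIndex ν h c ≠ blockIndex ν h d → B c d = 0) (j : Fin m) :
    blockProj ν h j * B = B * blockProj ν h j := by
  ext c d
  rw [blockProj, Matrix.diagonal_mul, Matrix.mul_diagonal]
  by_cases hcd : blockIndex ν h c = blockIndex ν h d
  · rw [hcd, mul_comm]
  · rw [hB c d hcd, mul_zero, zero_mul]

lemma coe_blockHom_apply_of_ne (U : ∀ j, UGroup (ν j)) (c d : Fin n)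
    (hcd : blockIndex ν h c ≠ blockIndex ν h d) :
    (blockHom ν h U : Matrix (Fin n) (Fin n) ℂ) c d = 0 := by
  change Matrix.blockDiagonal' (fun j => (U j : Matrix (Fin (ν j)) (Fin (ν j)) ℂ))
    ((finSigmaFinEquiv.trans (finCongr h)).symm c)
    ((finSigmaFinEquiv.trans (finCongr h)).symm d) = 0
  exact dif_neg hcd

/-- The relation `B B* = 1`, read block by block, makes every diagonal block unitary. -/
lemma mem_blockUnitary_of_zero {B : UGroup n}
    (hB : ∀ c d, blockIndex ν h c ≠ blockIndex ν h d →
      (B : Matrix (Fin n) (Fin n) ℂ) c d = 0) : B ∈ blockUnitary ν h := by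
  set ι := finSigmaFinEquiv.trans (finCongr h) with hι
  have hblock : (B : Matrix (Fin n) (Fin n) ℂ) = Matrix.reindex ι ι (Matrix.blockDiagonal'
      fun j => Matrix.of fun a b => (B : Matrix (Fin n) (Fin n) ℂ) (ι ⟨j, a⟩) (ι ⟨j, b⟩)) := by
    ext c d
    obtain ⟨⟨i, a⟩, rfl⟩ := ι.surjective c
    obtain ⟨⟨j, b⟩, rfl⟩ := ι.surjective d
    rw [Matrix.reindex_apply, Matrix.submatrix_apply, Equiv.symm_apply_apply,
      Equiv.symm_apply_apply]
    by_cases hij : i = j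
    · subst hij
      rw [Matrix.blockDiagonal'_apply_eq]
      rfl
    · rw [Matrix.blockDiagonal'_apply_ne _ _ _ hij]
      apply hB
      simpa [blockIndex, ← hι] using hij
  have hunit : ∀ j, (Matrix.of fun a b => (B : Matrix (Fin n) (Fin n) ℂ) (ι ⟨j, a⟩) (ι ⟨j, b⟩)) ∈
      Matrix.unitaryGroup (Fin (ν j)) ℂ := by
    have h1 := coe_mul_conjTranspose B
    rw [hblock, Matrix.conjTranspose_reindex, Matrix.blockDiagonal'_conjTranspose,
      Matrix.reindex_apply, Matrix.reindex_apply, Matrix.submatrix_mul_equiv,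
      ← Matrix.blockDiagonal'_mul] at h1
    have h2 := congrArg (Matrix.reindex ι.symm ι.symm) h1
    rw [Matrix.reindex_apply, Matrix.submatrix_submatrix] at h2
    simp only [Equiv.symm_symm, Equiv.symm_comp_self, Matrix.submatrix_id_id,
      Matrix.reindex_apply, Matrix.submatrix_one_equiv] at h2
    have h3 : Matrix.blockDiagonal' (fun j => (1 : Matrix (Fin (ν j)) (Fin (ν j)) ℂ)) = 1 :=
      Matrix.blockDiagonal'_one
    rw [← h3] at h2
    intro j
    rw [Matrix.mem_unitaryGroup_iff]
    exact congrFun (Matrix.blockDiagonal'_injective h2) j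
  exact ⟨fun j => ⟨_, hunit j⟩, Subtype.ext hblock.symm⟩

end Blocks

/-! ### Frames adapted to an orthogonal decomposition -/

/-- The projection `J E_j J⁻¹` onto the `j`-th block in the frame `J`. -/
def frameProj (J : UGroup n) {m : ℕ} (ν : Fin m → ℕ) (h : ∑ j, ν j = n) (j : Fin m) :
    Matrix (Fin n) (Fin n) ℂ :=
  (J : Matrix (Fin n) (Fin n) ℂ) * blockProj ν h j * (J : Matrix (Fin n) (Fin n) ℂ).conjTranspose

section Frame

variable (J : UGroup n) {m : ℕ} (ν : Fin m → ℕ) (h : ∑ j, ν j = n)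

lemma frameProj_conjTranspose (j : Fin m) :
    (frameProj J ν h j).conjTranspose = frameProj J ν h j := by
  simp only [frameProj, Matrix.conjTranspose_mul, Matrix.conjTranspose_conjTranspose,
    blockProj_conjTranspose, mul_assoc]

lemma frameProj_mul_self (j : Fin m) :
    frameProj J ν h j * frameProj J ν h j = frameProj J ν h j := by
  calc frameProj J ν h j * frameProj J ν h j
      = (J : Matrix (Fin n) (Fin n) ℂ) * blockProj ν h j *
          ((J : Matrix (Fin n) (Fin n) ℂ).conjTranspose * (J : Matrix (Fin n) (Fin n) ℂ)) *
          blockProj ν h j * (J : Matrix (Fin n) (Fin n) ℂ).conjTranspose := by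
        simp only [frameProj, mul_assoc]
    _ = frameProj J ν h j := by
        rw [conjTranspose_mul_coe, mul_one, mul_assoc (J : Matrix (Fin n) (Fin n) ℂ),
          blockProj_mul_self,
          frameProj]

lemma sum_frameProj : ∑ j, frameProj J ν h j = 1 := by
  simp only [frameProj, ← Finset.sum_mul, ← Finset.mul_sum]
  rw [sum_blockProj, mul_one, coe_mul_conjTranspose]

lemma frameProj_comm {u : UGroup n} (hu : u ∈ conjSubgroup J (blockUnitary ν h)) (j : Fin m) :
    frameProj J ν h j * (u : Matrix (Fin n) (Fin n) ℂ) = u * frameProj J ν h j := by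
  obtain ⟨_, ⟨U, rfl⟩, rfl⟩ := hu
  have hB := blockProj_mul_comm_of_zero ν h (coe_blockHom_apply_of_ne ν h U) j
  set B := blockHom ν h U
  have hcoe : (((MulAut.conj J).toMonoidHom B : UGroup n) : Matrix (Fin n) (Fin n) ℂ) =
      (J : Matrix (Fin n) (Fin n) ℂ) * B * (J : Matrix (Fin n) (Fin n) ℂ).conjTranspose := rfl
  rw [hcoe, frameProj]
  calc (J : Matrix (Fin n) (Fin n) ℂ) * blockProj ν h j *
        (J : Matrix (Fin n) (Fin n) ℂ).conjTranspose *
        ((J : Matrix (Fin n) (Fin n) ℂ) * B * (J : Matrix (Fin n) (Fin n) ℂ).conjTranspose)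
      = (J : Matrix (Fin n) (Fin n) ℂ) * blockProj ν h j *
        ((J : Matrix (Fin n) (Fin n) ℂ).conjTranspose * (J : Matrix (Fin n) (Fin n) ℂ)) *
        B * (J : Matrix (Fin n) (Fin n) ℂ).conjTranspose := by simp only [mul_assoc]
    _ = (J : Matrix (Fin n) (Fin n) ℂ) * (blockProj ν h j * B) *
        (J : Matrix (Fin n) (Fin n) ℂ).conjTranspose := by
        rw [conjTranspose_mul_coe, mul_one]; simp only [mul_assoc]
    _ = (J : Matrix (Fin n) (Fin n) ℂ) * B *
        ((J : Matrix (Fin n) (Fin n) ℂ).conjTranspose * (J : Matrix (Fin n) (Fin n) ℂ)) *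
        blockProj ν h j * (J : Matrix (Fin n) (Fin n) ℂ).conjTranspose := by
        rw [conjTranspose_mul_coe, mul_one, hB]; simp only [mul_assoc]
    _ = _ := by simp only [mul_assoc]

end Frame

/-- A frame adapted to an orthogonal decomposition of `ℂⁿ`. -/
lemma exists_adapted_frame {m : ℕ} {W : Fin m → Submodule ℂ (EuclideanSpace ℂ (Fin n))}
    (hO : OrthogonalFamily ℂ (fun j => W j) (fun j => (W j).subtypeₗᵢ))
    (hI : DirectSum.IsInternal W) (hW : ∀ j, W j ≠ ⊥) :
    ∃ (J : UGroup n) (ν : Fin m → ℕ) (h : ∑ j, ν j = n), (∀ j, 0 < ν j) ∧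
      (∀ c, WithLp.toLp 2 ((J : Matrix (Fin n) (Fin n) ℂ).mulVec (Pi.single c 1)) ∈
        W (blockIndex ν h c)) ∧
      (∀ j, ∀ z, WithLp.toLp 2 ((frameProj J ν h j).mulVec z) ∈ W j) ∧
      ∀ i j, ∀ v ∈ W j, (frameProj J ν h i).mulVec v.ofLp = if i = j then v.ofLp else 0 := by
  set ν : Fin m → ℕ := fun j => Module.finrank ℂ (W j)
  let b := hI.collectedOrthonormalBasis hO fun j => stdOrthonormalBasis ℂ (W j)
  have hb : ∀ a, b a ∈ W a.1 := fun a =>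
    DirectSum.IsInternal.collectedOrthonormalBasis_mem hI hO _ a
  have h : ∑ j, ν j = n := by
    have h1 := Module.finrank_eq_card_basis b.toBasis
    simpa [ν] using h1.symm
  set ι := finSigmaFinEquiv.trans (finCongr h) with hι
  let b' : OrthonormalBasis (Fin n) ℂ (EuclideanSpace ℂ (Fin n)) := b.reindex ι
  have hb' : ∀ c, b' c ∈ W (blockIndex ν h c) := by
    intro c
    rw [OrthonormalBasis.reindex_apply]
    exact hb _
  -- The columns of `J` are orthonormal bases of the `W j`, listed block by block.
  let J : UGroup n := ⟨(EuclideanSpace.basisFun (Fin n) ℂ).toBasis.toMatrix b',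
    OrthonormalBasis.toMatrix_orthonormalBasis_mem_unitary _ _⟩
  have hJ : ∀ c, (J : Matrix (Fin n) (Fin n) ℂ).mulVec (Pi.single c 1) = (b' c).ofLp := by
    intro c
    funext a
    simp [J, Module.Basis.toMatrix_apply]
  have hblock : ∀ j (y : Fin n → ℂ), (blockProj ν h j).mulVec y =
      fun c => if blockIndex ν h c = j then y c else 0 := by
    intro j y
    funext c
    simp [blockProj, Matrix.mulVec_diagonal]
  have hsum : ∀ y : Fin n → ℂ, (J : Matrix (Fin n) (Fin n) ℂ).mulVec y =
      ∑ c, y c • (b' c).ofLp := by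
    intro y
    conv_lhs => rw [pi_eq_sum_univ' y]
    rw [Matrix.mulVec_sum]
    refine Finset.sum_congr rfl fun c _ => ?_
    rw [Matrix.mulVec_smul, ← hJ]
  have hJt : ∀ (v : EuclideanSpace ℂ (Fin n)) c,
      (J : Matrix (Fin n) (Fin n) ℂ).conjTranspose.mulVec v.ofLp c = inner ℂ (b' c) v := by
    intro v c
    rw [inner_eq_herm, ← hJ, herm, Matrix.star_mulVec, dotProduct_comm,
      ← Matrix.dotProduct_mulVec]
    have : star (Pi.single c (1 : ℂ) : Fin n → ℂ) = Pi.single c 1 := by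
      rw [← Pi.single_star]; simp
    rw [this, single_dotProduct, one_mul]
  refine ⟨J, ν, h, fun j => ?_, fun c => ?_, fun j z => ?_, fun i j v hv => ?_⟩
  · exact Nat.pos_of_ne_zero fun h0 => hW j (Submodule.finrank_eq_zero.1 h0)
  · rw [hJ]
    exact hb' c
  · rw [frameProj, ← Matrix.mulVec_mulVec, ← Matrix.mulVec_mulVec, hsum, hblock, WithLp.toLp_sum]
    refine Submodule.sum_mem _ fun c _ => ?_
    rw [WithLp.toLp_smul]
    by_cases hc : blockIndex ν h c = j
    · exact Submodule.smul_mem _ _ (hc ▸ hb' c)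
    · simp [hc]
  · rw [frameProj, ← Matrix.mulVec_mulVec, ← Matrix.mulVec_mulVec, hblock]
    have hz : ∀ c, blockIndex ν h c ≠ j →
        (J : Matrix (Fin n) (Fin n) ℂ).conjTranspose.mulVec v.ofLp c = 0 := by
      intro c hc
      rw [hJt]
      exact (hO.isOrtho hc).inner_eq (hb' c) hv
    split_ifs with hij
    · subst hij
      have : (fun c => if blockIndex ν h c = i then
          (J : Matrix (Fin n) (Fin n) ℂ).conjTranspose.mulVec v.ofLp c else 0) =
          (J : Matrix (Fin n) (Fin n) ℂ).conjTranspose.mulVec v.ofLp := by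
        funext c
        split_ifs with hc
        · rfl
        · exact (hz c hc).symm
      rw [this, Matrix.mulVec_mulVec, coe_mul_conjTranspose, Matrix.one_mulVec]
    · have : (fun c => if blockIndex ν h c = i then
          (J : Matrix (Fin n) (Fin n) ℂ).conjTranspose.mulVec v.ofLp c else 0) = 0 := by
        funext c
        split_ifs with hc
        · exact hz c (hc ▸ hij)
        · rfl
      rw [this, Matrix.mulVec_zero]

/-- A group preserving each member of an orthogonal decomposition is block diagonal in an adapted
frame. -/
lemma le_conjSubgroup_blockUnitary {K : Subgroup (UGroup n)} {m : ℕ}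
    {W : Fin m → Submodule ℂ (EuclideanSpace ℂ (Fin n))}
    (hO : OrthogonalFamily ℂ (fun j => W j) (fun j => (W j).subtypeₗᵢ))
    (hinv : ∀ j, ∀ k, ∀ v ∈ W j, definingRep K k v ∈ W j)
    {J : UGroup n} {ν : Fin m → ℕ} {h : ∑ j, ν j = n}
    (hJ : ∀ c, WithLp.toLp 2 ((J : Matrix (Fin n) (Fin n) ℂ).mulVec (Pi.single c 1)) ∈
        W (blockIndex ν h c)) : K ≤ conjSubgroup J (blockUnitary ν h) := by
  intro k hk
  refine ⟨J⁻¹ * k * J, mem_blockUnitary_of_zero ν h fun c d hcd => ?_, ?_⟩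
  · have h1 : inner ℂ (WithLp.toLp 2 ((J : Matrix (Fin n) (Fin n) ℂ).mulVec (Pi.single c 1)))
        (definingRep K ⟨k, hk⟩
          (WithLp.toLp 2 ((J : Matrix (Fin n) (Fin n) ℂ).mulVec (Pi.single d 1)))) = (0 : ℂ) :=
      (hO.isOrtho hcd).inner_eq (hJ c) (hinv _ _ _ (hJ d))
    rw [inner_eq_herm, definingRep_apply, herm, act, Matrix.star_mulVec, dotProduct_comm,
      ← Matrix.dotProduct_mulVec, Matrix.mulVec_mulVec, Matrix.mulVec_mulVec] at h1
    have h2 : star (Pi.single c (1 : ℂ) : Fin n → ℂ) = Pi.single c 1 := by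
      rw [← Pi.single_star]; simp
    rw [h2, single_dotProduct, one_mul, Matrix.mulVec_single_one] at h1
    rw [← h1]
    change ((J : Matrix (Fin n) (Fin n) ℂ).conjTranspose * k * J) c d = _
    rw [mul_assoc]
    rfl
  · change J * (J⁻¹ * k * J) * J⁻¹ = k
    group

lemma exists_exp_mul_eq {c c' : ℂ} (hc : Complex.normSq c = Complex.normSq c') :
    ∃ θ : ℝ, Complex.exp (θ * Complex.I) * c = c' := by
  refine ⟨(c'.arg - c.arg : ℝ), ?_⟩
  have hn : ‖c‖ = ‖c'‖ := by
    rw [Complex.normSq_eq_norm_sq, Complex.normSq_eq_norm_sq] at hc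
    exact (sq_eq_sq₀ (norm_nonneg _) (norm_nonneg _)).1 hc
  calc Complex.exp ((c'.arg - c.arg : ℝ) * Complex.I) * c
      = Complex.exp ((c'.arg - c.arg : ℝ) * Complex.I) *
          (‖c‖ * Complex.exp (c.arg * Complex.I)) := by rw [Complex.norm_mul_exp_arg_mul_I]
    _ = ‖c'‖ * Complex.exp (c'.arg * Complex.I) := by
        rw [hn, mul_left_comm, ← Complex.exp_add]
        push_cast
        ring_nf
    _ = c' := Complex.norm_mul_exp_arg_mul_I c'

end PolarGelfand

end

/-! ### The main argument -/

theorem proposition10p2 (n : ℕ) (K : Subgroup (PolarGelfand.UGroup n))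
    (hcompact : IsCompact (K : Set (PolarGelfand.UGroup n)))
    (hconnected : IsConnected (K : Set (PolarGelfand.UGroup n)))
    (hGelfand : PolarGelfand.IsGelfandPair K)
    (T : Submodule ℝ (Fin n → ℂ)) (hT : PolarGelfand.IsTransversalDomain K T)
    (hdim : PolarGelfand.ClassOneDimOne K (PolarGelfand.stabilizer K T)) :
    ∃ (J : PolarGelfand.UGroup n) (m : ℕ) (ν : Fin m → ℕ) (h : ∑ j, ν j = n),
      (∀ j, 0 < ν j) ∧
      PolarGelfand.invariantPolynomials K =
        PolarGelfand.invariantPolynomials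
          (PolarGelfand.conjSubgroup J (PolarGelfand.blockUnitary ν h)) := by
  open PolarGelfand in
  obtain ⟨m, W, hO, hI, hmin⟩ :=
    exists_orthogonalFamily_isMinimalInvariant (inner_definingRep K)
  obtain ⟨J, ν, h, hν, hJ, hrange, hproj⟩ :=
    exists_adapted_frame hO hI fun j => (hmin j).ne_bot
  have hle : K ≤ conjSubgroup J (blockUnitary ν h) :=
    le_conjSubgroup_blockUnitary hO (fun j => (hmin j).invariant) hJ
  refine ⟨J, m, ν, h, hν, le_antisymm (fun p hp => ?_) fun p hp k hk => hp k (hle hk)⟩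
  choose e heW he0 hline using fun j => exists_fixed_line hT hdim (hmin j)
  have hcomm : ∀ u ∈ conjSubgroup J (blockUnitary ν h), ∀ j z,
      (frameProj J ν h j).mulVec (act u z) = act u ((frameProj J ν h j).mulVec z) := by
    intro u hu j z
    rw [act, act, Matrix.mulVec_mulVec, Matrix.mulVec_mulVec, frameProj_comm J ν h hu]
  have hPe : ∀ i j, (frameProj J ν h i).mulVec (e j).ofLp = if i = j then (e j).ofLp else 0 :=
    fun i j => hproj i j _ (heW j)
  -- Each `P_j` commutes with `M`, so it sends points of `T` to `M`-fixed vectors of `W j`, that is,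
  -- to multiples of `e j`.
  have hTsum : ∀ q ∈ T, ∃ c : Fin m → ℂ, q = ∑ j, c j • (e j).ofLp := by
    intro q hq
    have hc : ∀ j, ∃ c : ℂ, WithLp.toLp 2 ((frameProj J ν h j).mulVec q) = c • e j := by
      refine fun j => hline j _ (hrange j q) fun k hk => ?_
      rw [WithLp.ofLp_toLp, ← hcomm _ (hle k.2), hk q hq]
    choose c hc using hc
    refine ⟨c, ?_⟩
    calc q = (∑ j, frameProj J ν h j).mulVec q := by rw [sum_frameProj, Matrix.one_mulVec]
      _ = ∑ j, c j • (e j).ofLp := by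
        rw [Matrix.sum_mulVec]
        exact Finset.sum_congr rfl fun j _ => congrArg WithLp.ofLp (hc j)
  have hnorm : ∀ (c : Fin m → ℂ) j, normSqSum ((frameProj J ν h j).mulVec
      (∑ i, c i • (e i).ofLp)) = Complex.normSq (c j) * normSqSum (e j).ofLp := by
    intro c j
    rw [← normSqSum_smul]
    simp only [Matrix.mulVec_sum, Matrix.mulVec_smul, hPe]
    simp
  intro u hu z
  obtain ⟨k, hk, hkT⟩ := hT.meets z
  obtain ⟨k', hk', hkT'⟩ := hT.meets (act u z)
  obtain ⟨c, hc⟩ := hTsum _ hkT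
  obtain ⟨c', hc'⟩ := hTsum _ hkT'
  -- `k`, `k'` and `u` all lie in `K₀`, hence preserve the norm of every block component.
  have hcc : ∀ j, Complex.normSq (c j) = Complex.normSq (c' j) := by
    intro j
    have h1 := hnorm c j
    have h2 := hnorm c' j
    rw [← hc, hcomm k (hle hk), normSqSum_act] at h1
    rw [← hc', hcomm k' (hle hk'), normSqSum_act, hcomm u hu, normSqSum_act, h1] at h2
    refine mul_right_cancel₀ (fun h0 => he0 j ?_) h2
    exact WithLp.ofLp_injective 2 (normSqSum_eq_zero.1 h0)
  choose θ hθ using fun j => exists_exp_mul_eq (hcc j)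
  have hphase := evalAt_phase_eq hGelfand hp (frameProj_conjTranspose J ν h)
    (frameProj_mul_self J ν h) (fun j k hk => frameProj_comm J ν h (hle hk) j)
    (fun j => (e j).ofLp) hPe θ c
  simp only [hθ] at hphase
  rw [← hc, ← hc', hp k hk, hp k' hk'] at hphase
  exact hphase
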